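/- **Setting.** Indices $1,2,1'$ ($=3$) with $i'=4-i$ have parities $\bar 1=\bar 1'=1$, $\bar 2=0$, and $\theta_1=\theta_2=1$, $\theta_{1'}=-1$. Let $e_{ij}$ be the matrix units of the superalgebra $\operatorname{End}\mathbb C^{1|2}$ (of parity $\bar\imath+\bar\jmath$), $P=\sum e_{ij}\otimes e_{ji}(-1)^{\bar\jmath}$, $Q=\sum e_{ij}\otimes e_{i'j'}(-1)^{\bar\imath\bar\jmath}\theta_i\theta_j$ and $$R(u)=1-\frac{P}{u}+\frac{Q}{u-\kappa},\qquad \kappa=-\tfrac32 .$$ The extended Yangian $\mathrm X(\mathfrak{osp}_{1|2})$ is the superalgebra over $\mathbb C$ with generators $t_{ij}^{(r)}$, $r\ge 1$, of parity $\bar\imath+\bar\jmath$, and defining relations $R(u-v)T_1(u)T_2(v)=T_2(v)T_1(u)R(u-v)$, where $t_{ij}(u)=\delta_{ij}+\sum_{r\ge1}t_{ij}^{(r)}u^{-r}$ and $T(u)=\sum e_{ij}\otimes t_{ij}(u)(-1)^{\bar\imath\bar\jmath+\bar\jmath}$. The Yangian $\mathrm Y(\mathfrak{osp}_{1|2})$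 is the subalgebra of elements stable under all automorphisms $t_{ij}(u)\mapsto\varphi(u)t_{ij}(u)$ with $\varphi(u)\in 1+u^{-1}\mathbb C[[u^{-1}]]$. The coproduct $\Delta:t_{ij}(u)\mapsto\sum_k t_{ik}(u)\otimes t_{kj}(u)$ of $\mathrm X(\mathfrak{osp}_{1|2})$ restricts to a homomorphism $\Delta:\mathrm Y(\mathfrak{osp}_{1|2})\to \mathrm Y(\mathfrak{osp}_{1|2})\otimes \mathrm Y(\mathfrak{osp}_{1|2})$, where tensor products are those of superalgebras: $(a\otimes b)(a'\otimes b')=(-1)^{p(b)p(a')}aa'\otimes bb'$. Put $$h_1(u)=t_{11}(u),\quad h_2(u)=t_{22}(u)-t_{21}(u)t_{11}(u)^{-1}t_{12}(u),\quad k(u)=h_1(u)^{-1}h_2(u),$$ $$e(u)=h_1(u)^{-1}t_{12}(u),\quad e_{11'}(u)=h_1(u)^{-1}t_{11'}(u),\quad f(u)=t_{21}(u)h_1(u)^{-1},\quad f_{1'1}(u)=t_{1'1}(u)h_1(u)^{-1}.$$ The coefficients of $k,e,e_{11'},f,f_{1'1}$ lie in $\mathrm Y(\mathfrak{osp}_{1|2})$;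 shifted series such as $f(u+1)$ are expanded in powers of $u^{-1}$. **Proposition.** In $\big(\mathrm Y(\mathfrak{osp}_{1|2})\otimes\mathrm Y(\mathfrak{osp}_{1|2})\big)[[u^{-1}]]$, with both infinite series converging as formal power series in $u^{-1}$, we have $$\Delta(e(u))=1\otimes e(u)+\sum_{r=0}^{\infty}(-1)^r\Big(e(u)\otimes f(u+1)+e_{11'}(u)\otimes\big(f_{1'1}(u+1)-2f(u+1)^2\big)\Big)^r\Big(e(u)\otimes1+e_{11'}(u)\otimes\big(\tfrac13f(u-\tfrac12)+\tfrac23f(u+1)\big)\Big)\big(1\otimes k(u)\big)$$ and $$\Delta(f(u))=f(u)\otimes1+\big(k(u)\otimes1\big)\Big(1\otimes f(u)-\big(\tfrac13e(u-\tfrac12)+\tfrac23e(u+1)\big)\otimes f_{1'1}(u)\Big)\sum_{r=0}^{\infty}(-1)^r\Big(e(u+1)\otimes f(u)+\big(e_{11'}(u+1)+2e(u+1)^2\big)\otimes f_{1'1}(u)\Big)^r .$$ -/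

import Mathlib

open scoped PowerSeries TensorProduct DirectSum

noncomputable section

namespace OspYangian

/-! ### Superalgebras

A `ℤ/2`-grading of a complex algebra is recorded by its parity automorphism `σ`, which is `1` on the
even part and `-1` on the odd part. -/

section SuperGrading

/-- The homogeneous component of parity `i`: the `(-1)^i`-eigenspace of the parity automorphism. -/
def superPart {A : Type*} [Ring A] [Algebra ℂ A] (σ : A →ₐ[ℂ] A) (i : ZMod 2) : Submodule ℂ A where
  carrier := {a | σ a = (-1 : ℂ) ^ i.val • a}
  add_mem' := by
    intro a b ha hb
    simp only [Set.mem_ofPred_eq] at *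
    rw [map_add, ha, hb, smul_add]
  zero_mem' := by simp
  smul_mem' := by
    intro c a ha
    simp only [Set.mem_ofPred_eq] at *
    rw [map_smul, ha, smul_comm]

theorem mem_superPart {A : Type*} [Ring A] [Algebra ℂ A] {σ : A →ₐ[ℂ] A} {i : ZMod 2} {a : A} :
    a ∈ superPart σ i ↔ σ a = (-1 : ℂ) ^ i.val • a := Iff.rfl

theorem neg_one_pow_val_add (i j : ZMod 2) :
    (-1 : ℂ) ^ (i + j).val = (-1 : ℂ) ^ i.val * (-1 : ℂ) ^ j.val := by
  rw [ZMod.val_add, ← pow_add, neg_one_pow_eq_pow_mod_two (n := i.val + j.val)]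

theorem val_zero_two : (0 : ZMod 2).val = 0 := rfl

theorem val_one_two : (1 : ZMod 2).val = 1 := rfl

theorem add_eq_one_of_ne : ∀ i j : ZMod 2, j ≠ i → j + i = 1 := by decide

/-- The projection to the component of parity `i` along the other one. -/
def superProj {A : Type*} [Ring A] [Algebra ℂ A] (σ : A →ₐ[ℂ] A)
    (hσ : ∀ a, σ (σ a) = a) (i : ZMod 2) : A →ₗ[ℂ] superPart σ i :=
  LinearMap.codRestrict (superPart σ i)
    ((1 / 2 : ℂ) • (LinearMap.id + (-1 : ℂ) ^ i.val • σ.toLinearMap)) (by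
      intro a
      rw [mem_superPart]
      have h : (-1 : ℂ) ^ i.val * (-1 : ℂ) ^ i.val = 1 := by rw [← mul_pow]; simp
      simp only [LinearMap.smul_apply, LinearMap.add_apply, LinearMap.id_apply,
        AlgHom.toLinearMap_apply, map_smul, map_add, hσ, smul_add, smul_smul]
      rw [add_comm]
      congr 2
      · ring
      · rw [mul_left_comm, h, mul_one])

theorem coe_superProj {A : Type*} [Ring A] [Algebra ℂ A] (σ : A →ₐ[ℂ] A)
    (hσ : ∀ a, σ (σ a) = a) (i : ZMod 2) (a : A) :
    (superProj σ hσ i a : A) = (1 / 2 : ℂ) • (a + (-1 : ℂ) ^ i.val • σ a) := rfl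

/-- The homogeneous components of an involutive parity automorphism form a grading. -/
@[reducible]
def superGradedAlgebra {A : Type*} [Ring A] [Algebra ℂ A] (σ : A →ₐ[ℂ] A)
    (hσ : ∀ a, σ (σ a) = a) : GradedAlgebra (superPart σ) where
  one_mem := by simp [mem_superPart]
  mul_mem := by
    intro i j a b ha hb
    rw [mem_superPart] at *
    rw [map_mul, ha, hb, neg_one_pow_val_add, smul_mul_smul_comm]
  toDecomposition := DirectSum.Decomposition.ofLinearMap _
    (∑ i : ZMod 2, (DirectSum.lof ℂ (ZMod 2) (fun i => superPart σ i) i).comp (superProj σ hσ i))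
    (by
      ext a
      have h2 : (Finset.univ : Finset (ZMod 2)) = {0, 1} := rfl
      simp only [h2, LinearMap.comp_apply, LinearMap.sum_apply, map_sum,
        DirectSum.coeLinearMap_lof, coe_superProj, LinearMap.id_apply]
      rw [Finset.sum_pair (by decide), val_zero_two, val_one_two, ← smul_add]
      have : a + (-1 : ℂ) ^ 0 • σ a + (a + (-1 : ℂ) ^ 1 • σ a) = (2 : ℂ) • a := by
        rw [two_smul]; simp; abel
      rw [this, smul_smul]; norm_num)
    (by
      ext i x : 2
      have hx : σ (x : A) = (-1 : ℂ) ^ i.val • (x : A) := x.2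
      simp only [LinearMap.comp_apply, LinearMap.sum_apply, DirectSum.coeLinearMap_lof,
        LinearMap.id_apply]
      rw [Finset.sum_eq_single i]
      · congr 1
        apply Subtype.ext
        rw [coe_superProj, hx, smul_smul, ← mul_pow]
        simp only [neg_mul_neg, one_mul, one_pow, one_smul, ← two_smul ℂ (x : A), smul_smul]
        norm_num
      · intro j _ hj
        have : superProj σ hσ j (x : A) = 0 := by
          apply Subtype.ext
          rw [coe_superProj, hx, smul_smul]
          have h : (-1 : ℂ) ^ j.val * (-1 : ℂ) ^ i.val = -1 := by
            rw [← neg_one_pow_val_add]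
            have : j + i = 1 := add_eq_one_of_ne i j hj
            rw [this, val_one_two, pow_one]
          rw [h]; simp
        rw [this, map_zero]
      · simp)

end SuperGrading

/-! ### The RTT relation for `osp(1|2)`

The indices `1, 2, 1'` are written `0, 1, 2 : Fin 3`, so that `i'` is `Fin.rev i`. A formal series
`∑ aᵣ u^{-r}` is the power series `∑ aᵣ X^r`, that is, `X` is `u⁻¹`. -/

/-- The parity of the basis vector `e_i` of `ℂ^{1|2}` (an index is odd unless it is the middle one). -/
def par (i : Fin 3) : ℕ := if i = 1 then 0 else 1

/-- The signs `θ₁ = θ₂ = 1`, `θ_{1'} = -1`. -/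
def theta (i : Fin 3) : ℂ := if i = 2 then -1 else 1

/-- The parameter `κ = -m - 1/2` for `m = 1`. -/
def kappa : ℂ := -3 / 2

/-- `a : Tens A` stands for `∑ e_{ij} ⊗ e_{kl} ⊗ a i j k l` in `End ℂ^{1|2} ⊗ End ℂ^{1|2} ⊗ A`.
All elements used below are even, that is, `a i j k l` has the parity of `e_{ij} ⊗ e_{kl}`. -/
abbrev Tens (A : Type*) := Fin 3 → Fin 3 → Fin 3 → Fin 3 → A

/-- The product of even elements of the superalgebra `End ℂ^{1|2} ⊗ End ℂ^{1|2} ⊗ A`. The sign is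
the one produced by the rule `(x ⊗ y)(x' ⊗ y') = (-1)^{p(y)p(x')} xx' ⊗ yy'`: in
`(e_{im} ⊗ e_{kn} ⊗ a)(e_{mj} ⊗ e_{nl} ⊗ b)` the factor `e_{mj}` moves past `e_{kn} ⊗ a`, whose
parity is that of `e_{im}`, and `e_{nl}` moves past `a`, whose parity is that of
`e_{im} ⊗ e_{kn}`. -/
def tensMul {A : Type*} [Ring A] (a b : Tens A) : Tens A := fun i j k l =>
  ∑ m, ∑ n, (-1 : A) ^ ((par i + par m) * (par m + par j) +
    (par i + par m + par k + par n) * (par n + par l)) * (a i m k n * b m j n l)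

/-- The identity element `1 ⊗ 1 ⊗ 1`. -/
def tensOne {A : Type*} [Ring A] : Tens A := fun i j k l => if i = j ∧ k = l then 1 else 0

/-- `P = ∑ e_{ij} ⊗ e_{ji} (-1)^{p(j)}`. -/
def tensP {A : Type*} [Ring A] : Tens A := fun i j k l =>
  if k = j ∧ l = i then (-1) ^ par j else 0

/-- `Q = ∑ e_{ij} ⊗ e_{i'j'} (-1)^{p(i)p(j)} θ_i θ_j`. -/
def tensQ {A : Type*} [Ring A] [Algebra ℂ A] : Tens A := fun i j k l =>
  if k = i.rev ∧ l = j.rev then algebraMap ℂ A ((-1) ^ (par i * par j) * theta i * theta j) else 0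

/-- The element `a_1 = ∑ e_{ij} ⊗ 1 ⊗ a_{ij} (-1)^{p(i)p(j)+p(j)}` for an even matrix `a`. -/
def tensFst {A : Type*} [Ring A] (a : Fin 3 → Fin 3 → A) : Tens A := fun i j k l =>
  if k = l then (-1) ^ (par i * par j + par j) * a i j else 0

/-- The element `a_2 = ∑ 1 ⊗ e_{ij} ⊗ a_{ij} (-1)^{p(i)p(j)+p(j)}` for an even matrix `a`. -/
def tensSnd {A : Type*} [Ring A] (a : Fin 3 → Fin 3 → A) : Tens A := fun i j k l =>
  if i = j then (-1) ^ (par k * par l + par l) * a k l else 0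

section TwoVariables

variable (A : Type*) [Ring A]

/-- `u⁻¹`, in the ring `A⟦X⟧⟦X⟧` of formal series in `u⁻¹` (outer variable) and `v⁻¹` (inner). -/
def uInv : A⟦X⟧⟦X⟧ := PowerSeries.X

/-- `v⁻¹`. -/
def vInv : A⟦X⟧⟦X⟧ := PowerSeries.C PowerSeries.X

variable {A}

/-- The series `a(u)`. -/
def atU : A⟦X⟧ →+* A⟦X⟧⟦X⟧ := PowerSeries.map PowerSeries.C

/-- The series `a(v)`. -/
def atV : A⟦X⟧ →+* A⟦X⟧⟦X⟧ := PowerSeries.C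

end TwoVariables

/-- The `R`-matrix `R(u - v) = 1 - P / (u - v) + Q / (u - v - κ)` with its denominators cleared:
this is `u⁻² v⁻² (u - v) (u - v - κ) R(u - v)`, written through
`u⁻¹ v⁻¹ (u - v) = v⁻¹ - u⁻¹` and `u⁻¹ v⁻¹ (u - v - κ) = v⁻¹ - u⁻¹ - κ u⁻¹ v⁻¹`. -/
def rMatrix (A : Type*) [Ring A] [Algebra ℂ A] : Tens (A⟦X⟧⟦X⟧) := fun i j k l =>
  (vInv A - uInv A) * (vInv A - uInv A - kappa • (uInv A * vInv A)) * tensOne i j k l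
  - uInv A * vInv A * (vInv A - uInv A - kappa • (uInv A * vInv A)) * tensP i j k l
  + uInv A * vInv A * (vInv A - uInv A) * tensQ i j k l

/-- The difference `R(u - v) T₁(u) T₂(v) - T₂(v) T₁(u) R(u - v)`, with denominators cleared. -/
def rttDefect {A : Type*} [Ring A] [Algebra ℂ A] (T : Fin 3 → Fin 3 → A⟦X⟧) : Tens (A⟦X⟧⟦X⟧) :=
  tensMul (tensMul (rMatrix A) (tensFst fun i j => atU (T i j))) (tensSnd fun i j => atV (T i j))
  - tensMul (tensMul (tensSnd fun i j => atV (T i j)) (tensFst fun i j => atU (T i j))) (rMatrix A)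

/-- The index `(i, j, r)` labels the generator `t_{ij}^{(r+1)}`. -/
abbrev Gen := Fin 3 × Fin 3 × ℕ

/-- The matrix `δ_{ij} + ∑_{r ≥ 1} a_{ij}^{(r)} u^{-r}` built from a family of coefficients. -/
def genSeries {A : Type*} [Ring A] (a : Gen → A) (i j : Fin 3) : A⟦X⟧ := PowerSeries.mk fun r =>
  match r with
  | 0 => if i = j then 1 else 0
  | r + 1 => a (i, j, r)

/-- The defining relations of the extended Yangian: all coefficients of the `RTT`-relation. -/
inductive RTTRel : FreeAlgebra ℂ Gen → FreeAlgebra ℂ Gen → Prop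
  | rtt (i j k l : Fin 3) (m n : ℕ) :
      RTTRel (PowerSeries.coeff n (PowerSeries.coeff m
        (rttDefect (genSeries (FreeAlgebra.ι ℂ)) i j k l))) 0

/-- The extended Yangian `X(osp(1|2))`. -/
def ExtYangian : Type := RingQuot RTTRel

instance : Ring ExtYangian := inferInstanceAs (Ring (RingQuot RTTRel))

instance : Algebra ℂ ExtYangian := inferInstanceAs (Algebra ℂ (RingQuot RTTRel))

/-- The generator `t_{ij}^{(r+1)}` of the extended Yangian. -/
def gen (x : Gen) : ExtYangian := RingQuot.mkAlgHom ℂ RTTRel (FreeAlgebra.ι ℂ x)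

/-- The series `t_{ij}(u)`. -/
def tSeries (i j : Fin 3) : ExtYangian⟦X⟧ := genSeries gen i j

/-! #### Functoriality and the universal property -/

theorem genSeries_coeff {A : Type*} [Ring A] (T : Fin 3 → Fin 3 → A⟦X⟧)
    (hT : ∀ i j, PowerSeries.constantCoeff (T i j) = if i = j then 1 else 0) :
    genSeries (fun x : Gen => PowerSeries.coeff (x.2.2 + 1) (T x.1 x.2.1)) = T := by
  funext i j
  ext r
  cases r with
  | zero => simp [genSeries, hT]
  | succ r => simp [genSeries]

section Map

variable {A B : Type*} [Ring A] [Ring B] [Algebra ℂ A] [Algebra ℂ B]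

theorem map_genSeries (f : A →ₐ[ℂ] B) (a : Gen → A) (i j : Fin 3) :
    PowerSeries.map (f : A →+* B) (genSeries a i j) = genSeries (fun x => f (a x)) i j := by
  ext r
  cases r with
  | zero => simp only [genSeries, PowerSeries.coeff_map, PowerSeries.coeff_mk]; split_ifs <;> simp
  | succ r => simp [genSeries]

/-- The map induced on series in two variables. -/
def map₂ (f : A →ₐ[ℂ] B) : A⟦X⟧⟦X⟧ →+* B⟦X⟧⟦X⟧ :=
  PowerSeries.map (PowerSeries.map (f : A →+* B))

theorem map₂_uInv (f : A →ₐ[ℂ] B) : map₂ f (uInv A) = uInv B := by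
  simp [map₂, uInv]

theorem map₂_vInv (f : A →ₐ[ℂ] B) : map₂ f (vInv A) = vInv B := by
  simp [map₂, vInv]

theorem map₂_atU (f : A →ₐ[ℂ] B) (a : A⟦X⟧) :
    map₂ f (atU a) = atU (PowerSeries.map (f : A →+* B) a) := by
  ext m n
  simp only [map₂, atU, PowerSeries.coeff_map, PowerSeries.map_C]

theorem map₂_atV (f : A →ₐ[ℂ] B) (a : A⟦X⟧) :
    map₂ f (atV a) = atV (PowerSeries.map (f : A →+* B) a) := by
  simp [map₂, atV]

theorem map₂_smul (f : A →ₐ[ℂ] B) (c : ℂ) (a : A⟦X⟧⟦X⟧) : map₂ f (c • a) = c • map₂ f a := by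
  ext m n
  simp [map₂]

theorem map₂_algebraMap (f : A →ₐ[ℂ] B) (c : ℂ) :
    map₂ f (algebraMap ℂ (A⟦X⟧⟦X⟧) c) = algebraMap ℂ (B⟦X⟧⟦X⟧) c := by
  rw [Algebra.algebraMap_eq_smul_one, Algebra.algebraMap_eq_smul_one, map₂_smul, map_one]

theorem map_tensMul {A B : Type*} [Ring A] [Ring B] (f : A →+* B) (a b : Tens A) (i j k l : Fin 3) :
    f (tensMul a b i j k l) =
      tensMul (fun i j k l => f (a i j k l)) (fun i j k l => f (b i j k l)) i j k l := by
  simp [tensMul]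

theorem map₂_rMatrix (f : A →ₐ[ℂ] B) (i j k l : Fin 3) :
    map₂ f (rMatrix A i j k l) = rMatrix B i j k l := by
  simp only [rMatrix, map_add, map_sub, map_mul, map₂_smul, map₂_uInv, map₂_vInv, tensOne, tensP,
    tensQ, apply_ite (map₂ f), map_one, map_zero, map_pow, map_neg, map₂_algebraMap]

theorem map₂_rttDefect (f : A →ₐ[ℂ] B) (T : Fin 3 → Fin 3 → A⟦X⟧) (i j k l : Fin 3) :
    map₂ f (rttDefect T i j k l) =
      rttDefect (fun i j => PowerSeries.map (f : A →+* B) (T i j)) i j k l := by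
  simp only [rttDefect, Pi.sub_apply, map_sub, map_tensMul, map₂_rMatrix, tensFst, tensSnd,
    apply_ite (map₂ f), map_zero, map_mul, map_pow, map_neg, map_one, map₂_atU, map₂_atV]
  rfl

end Map

theorem rttDefect_tSeries : rttDefect tSeries = 0 := by
  funext i j k l
  have h := map₂_rttDefect (RingQuot.mkAlgHom ℂ RTTRel) (genSeries (FreeAlgebra.ι ℂ)) i j k l
  simp only [map_genSeries] at h
  have h' : rttDefect tSeries i j k l = map₂ (RingQuot.mkAlgHom ℂ RTTRel)
      (rttDefect (genSeries (FreeAlgebra.ι ℂ)) i j k l) := h.symm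
  rw [h']
  ext m n
  have := RingQuot.mkAlgHom_rel ℂ (RTTRel.rtt i j k l m n)
  rw [map_zero] at this
  exact this

/-- The universal property of the extended Yangian: a matrix of series satisfying the
`RTT`-relation gives a homomorphism. -/
def liftX {B : Type*} [Ring B] [Algebra ℂ B] (T : Fin 3 → Fin 3 → B⟦X⟧)
    (h0 : ∀ i j, PowerSeries.constantCoeff (T i j) = if i = j then 1 else 0)
    (h : rttDefect T = 0) : ExtYangian →ₐ[ℂ] B :=
  RingQuot.liftAlgHom ℂ ⟨FreeAlgebra.lift ℂ fun x => PowerSeries.coeff (x.2.2 + 1) (T x.1 x.2.1), by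
    intro a b hab
    obtain ⟨i, j, k, l, m, n⟩ := hab
    have h1 := map₂_rttDefect (FreeAlgebra.lift ℂ fun x : Gen =>
      PowerSeries.coeff (x.2.2 + 1) (T x.1 x.2.1)) (genSeries (FreeAlgebra.ι ℂ)) i j k l
    simp only [map_genSeries, FreeAlgebra.lift_ι_apply, genSeries_coeff T h0] at h1
    have h2 := congrArg (fun s => PowerSeries.coeff n (PowerSeries.coeff m s)) h1
    rw [map_zero]
    refine Eq.trans h2 ?_
    simp [h]⟩

theorem map_liftX {B : Type*} [Ring B] [Algebra ℂ B] (T : Fin 3 → Fin 3 → B⟦X⟧)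
    (h0 : ∀ i j, PowerSeries.constantCoeff (T i j) = if i = j then 1 else 0)
    (h : rttDefect T = 0) (i j : Fin 3) :
    PowerSeries.map (liftX T h0 h : ExtYangian →+* B) (tSeries i j) = T i j := by
  rw [tSeries, map_genSeries]
  have : (fun x => liftX T h0 h (gen x)) =
      fun x : Gen => PowerSeries.coeff (x.2.2 + 1) (T x.1 x.2.1) := by
    funext x
    erw [RingQuot.liftAlgHom_mkAlgHom_apply]
    simp
  rw [this, genSeries_coeff T h0]

theorem extYangian_hom_ext {B : Type*} [Ring B] [Algebra ℂ B] {f g : ExtYangian →ₐ[ℂ] B}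
    (h : ∀ i j, PowerSeries.map (f : ExtYangian →+* B) (tSeries i j) =
      PowerSeries.map (g : ExtYangian →+* B) (tSeries i j)) : f = g := by
  refine RingQuot.ringQuot_ext' (s := RTTRel) ℂ f g ?_
  apply FreeAlgebra.hom_ext
  funext x
  have := congrArg (PowerSeries.coeff (x.2.2 + 1)) (h x.1 x.2.1)
  simp only [tSeries, genSeries, PowerSeries.coeff_map, PowerSeries.coeff_mk] at this
  exact this

theorem constantCoeff_tSeries (i j : Fin 3) :
    PowerSeries.constantCoeff (tSeries i j) = if i = j then 1 else 0 := by
  simp [tSeries, genSeries, ← PowerSeries.coeff_zero_eq_constantCoeff_apply]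

/-! #### Algebraic properties of the signed product -/

section TensMul

variable {A : Type*} [Ring A]

theorem par_sq (R : Type) [CommRing R] (i : Fin 3) : (par i : R) ^ 2 = par i := by
  unfold par; split_ifs <;> simp

theorem neg_one_pow_congr' {m n : ℕ}
    (h : ∀ (R : Type) [CommRing R], (2 : R) = 0 → (m : R) = n) : (-1 : A) ^ m = (-1) ^ n := by
  replace h := h (ZMod 2) rfl
  rw [neg_one_pow_eq_pow_mod_two (n := m), neg_one_pow_eq_pow_mod_two (n := n)]
  rw [(ZMod.natCast_eq_natCast_iff' m n 2).mp h]

theorem sign_mul_mul (m n : ℕ) (a b : A) :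
    (-1 : A) ^ m * (a * ((-1) ^ n * b)) = (-1) ^ (m + n) * (a * b) := by
  rw [pow_add, mul_assoc, ← mul_assoc a, ← ((Commute.neg_one_left a).pow_left n).eq, mul_assoc]

theorem sign_mul_mul' (m n : ℕ) (a b : A) :
    (-1 : A) ^ m * (((-1) ^ n * a) * b) = (-1) ^ (m + n) * (a * b) := by
  rw [pow_add, mul_assoc, mul_assoc]

theorem tensMul_assoc (a b c : Tens A) : tensMul (tensMul a b) c = tensMul a (tensMul b c) := by
  funext i j k l
  have e1 : ∀ i m n k j l m' n', (-1 : A) ^ ((par i + par m') * (par m' + par j) +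
      (par i + par m' + par k + par n') * (par n' + par l)) *
      ((-1) ^ ((par i + par m) * (par m + par m') + (par i + par m + par k + par n) *
      (par n + par n')) * (a i m k n * b m m' n n') * c m' j n' l) =
      (-1 : A) ^ ((par i + par m) * (par m + par j) +
      (par i + par m + par k + par n) * (par n + par l)) *
      (a i m k n * ((-1) ^ ((par m + par m') * (par m' + par j) +
      (par m + par m' + par n + par n') * (par n' + par l)) * (b m m' n n' * c m' j n' l))) := by
    intro i m n k j l m' n'
    rw [sign_mul_mul, sign_mul_mul', mul_assoc (a i m k n)]
    congr 1
    apply neg_one_pow_congr'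
    intro R _ h2
    push_cast
    grind
  simp only [tensMul, Finset.mul_sum, Finset.sum_mul]
  have hL : ∀ f : Fin 3 → Fin 3 → Fin 3 → Fin 3 → A,
      ∑ m', ∑ n', ∑ m, ∑ n, f m' n' m n = ∑ m, ∑ n, ∑ m', ∑ n', f m' n' m n := by
    intro f
    rw [Finset.sum_congr rfl fun m' _ => Finset.sum_comm, Finset.sum_comm]
    refine Finset.sum_congr rfl fun m _ => ?_
    rw [Finset.sum_congr rfl fun m' _ => Finset.sum_comm, Finset.sum_comm]
  rw [hL]
  refine Finset.sum_congr rfl fun m _ => Finset.sum_congr rfl fun n _ =>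
    Finset.sum_congr rfl fun m' _ => Finset.sum_congr rfl fun n' _ => e1 _ _ _ _ _ _ _ _

theorem tensMul_smul_left (z : A) (a b : Tens A) :
    tensMul (fun i j k l => z * a i j k l) b = fun i j k l => z * tensMul a b i j k l := by
  funext i j k l
  simp only [tensMul, Finset.mul_sum]
  refine Finset.sum_congr rfl fun m _ => Finset.sum_congr rfl fun n _ => ?_
  rw [← mul_assoc z, ← ((Commute.neg_one_left z).pow_left _).eq]
  simp only [mul_assoc]

theorem tensMul_smul_right (z : A) (hz : ∀ x, z * x = x * z) (a b : Tens A) :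
    tensMul a (fun i j k l => z * b i j k l) = fun i j k l => z * tensMul a b i j k l := by
  funext i j k l
  simp only [tensMul, Finset.mul_sum]
  refine Finset.sum_congr rfl fun m _ => Finset.sum_congr rfl fun n _ => ?_
  rw [hz, ← mul_assoc (a i m k n), ← mul_assoc, ← hz]

/-- The parity automorphism on families of coefficients. -/
def tensSign (a : Tens A) : Tens A := fun i j k l =>
  (-1) ^ (par i + par j + par k + par l) * a i j k l

theorem tensMul_sign (a b : Tens A) :
    tensMul (tensSign a) (tensSign b) = tensSign (tensMul a b) := by
  funext i j k l
  simp only [tensMul, tensSign, Finset.mul_sum]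
  refine Finset.sum_congr rfl fun m _ => Finset.sum_congr rfl fun n _ => ?_
  rw [mul_assoc ((-1) ^ _) (a i m k n), sign_mul_mul, ← mul_assoc, ← pow_add,
    ← mul_assoc ((-1) ^ (par i + par j + par k + par l)), ← pow_add]
  congr 1
  apply neg_one_pow_congr'
  intro R _ h2
  push_cast
  grind

theorem tensMul_fst_snd (a b : Fin 3 → Fin 3 → A)
    (h : ∀ i j k l, a i j * b k l = (-1) ^ ((par i + par j) * (par k + par l)) * (b k l * a i j)) :
    tensMul (tensFst a) (tensSnd b) = tensMul (tensSnd b) (tensFst a) := by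
  funext i j k l
  have h1 : tensMul (tensFst a) (tensSnd b) i j k l =
      (-1) ^ ((par i + par j) * (par k + par l)) * (((-1) ^ (par i * par j + par j) * a i j) *
        ((-1) ^ (par k * par l + par l) * b k l)) := by
    simp only [tensMul, tensFst, tensSnd]
    rw [Finset.sum_eq_single j, Finset.sum_eq_single k]
    · simp only [if_true]
      congr 1
      apply neg_one_pow_congr'
      intro R _ h2
      push_cast
      grind
    · intro n _ hn; simp [hn.symm]
    · simp
    · intro m _ hm; simp [hm]
    · simp
  have h2 : tensMul (tensSnd b) (tensFst a) i j k l =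
      ((-1) ^ (par k * par l + par l) * b k l) * ((-1) ^ (par i * par j + par j) * a i j) := by
    simp only [tensMul, tensFst, tensSnd]
    rw [Finset.sum_eq_single i, Finset.sum_eq_single l]
    · simp only [if_true]
      rw [neg_one_pow_congr' (n := 0), pow_zero, one_mul]
      intro R _ h2
      push_cast
      grind
    · intro n _ hn; simp [hn]
    · simp
    · intro m _ hm; simp [hm.symm]
    · simp
  rw [h1, h2]
  rw [mul_assoc, sign_mul_mul, ← mul_assoc, ← pow_add, mul_assoc ((-1) ^ _) (b k l),
    ← one_mul ((-1) ^ (par k * par l + par l) * _), ← pow_zero (-1 : A), pow_zero, one_mul,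
    ← mul_assoc (b k l), ← ((Commute.neg_one_left (b k l)).pow_left _).eq, mul_assoc,
    ← mul_assoc ((-1) ^ _) ((-1) ^ _), ← pow_add, h, ← mul_assoc, ← pow_add]
  congr 1
  apply neg_one_pow_congr'
  intro R _ h2
  push_cast
  grind

theorem tensMul_fst_fst (a b : Fin 3 → Fin 3 → A) :
    tensMul (tensFst a) (tensFst b) = tensFst (fun i j => ∑ k, a i k * b k j) := by
  funext i j k l
  simp only [tensMul, tensFst]
  by_cases hkl : k = l
  · subst hkl
    simp only [if_true, Finset.mul_sum]
    refine Finset.sum_congr rfl fun m _ => ?_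
    rw [Finset.sum_eq_single k]
    · simp only [if_true]
      rw [mul_assoc ((-1) ^ _) (a i m), sign_mul_mul, ← mul_assoc, ← pow_add]
      congr 1
      apply neg_one_pow_congr'
      intro R _ h2
      have h3 := par_sq R m
      push_cast
      grind
    · intro n _ hn; simp [hn]
    · simp
  · rw [if_neg hkl]
    refine Finset.sum_eq_zero fun m _ => Finset.sum_eq_zero fun n _ => ?_
    by_cases h : k = n
    · subst h; simp [hkl]
    · simp [h]

theorem tensMul_snd_snd (a b : Fin 3 → Fin 3 → A) :
    tensMul (tensSnd a) (tensSnd b) = tensSnd (fun i j => ∑ k, a i k * b k j) := by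
  funext i j k l
  simp only [tensMul, tensSnd]
  by_cases hij : i = j
  · subst hij
    simp only [if_true, Finset.mul_sum]
    rw [Finset.sum_eq_single i]
    · refine Finset.sum_congr rfl fun n _ => ?_
      simp only [if_true]
      rw [mul_assoc ((-1) ^ _) (a k n), sign_mul_mul, ← mul_assoc, ← pow_add]
      congr 1
      apply neg_one_pow_congr'
      intro R _ h2
      have h3 := par_sq R n
      push_cast
      grind
    · intro n _ hn; simp [hn.symm]
    · simp
  · rw [if_neg hij]
    refine Finset.sum_eq_zero fun m _ => Finset.sum_eq_zero fun n _ => ?_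
    by_cases h : i = m
    · subst h; simp [hij]
    · simp [h]

end TensMul

/-! #### Solutions of the RTT relation -/

section Solutions

variable {A : Type*} [Ring A]

theorem coeff_atU_mul_atV (a b : A⟦X⟧) (m n : ℕ) :
    PowerSeries.coeff n (PowerSeries.coeff m (atU a * atV b)) =
      PowerSeries.coeff m a * PowerSeries.coeff n b := by
  simp [atU, atV, PowerSeries.coeff_mul_C, PowerSeries.coeff_C_mul]

theorem coeff_atV_mul_atU (a b : A⟦X⟧) (m n : ℕ) :
    PowerSeries.coeff n (PowerSeries.coeff m (atV b * atU a)) =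
      PowerSeries.coeff n b * PowerSeries.coeff m a := by
  simp [atU, atV, PowerSeries.coeff_mul_C, PowerSeries.coeff_C_mul]

theorem coeff_sign_mul (p m n : ℕ) (x : A⟦X⟧⟦X⟧) :
    PowerSeries.coeff n (PowerSeries.coeff m ((-1) ^ p * x)) =
      (-1) ^ p * PowerSeries.coeff n (PowerSeries.coeff m x) := by
  rcases neg_one_pow_eq_or (A⟦X⟧⟦X⟧) p with h | h
  · rcases Nat.even_or_odd p with h' | h'
    · simp [h'.neg_one_pow]
    · simp [h'.neg_one_pow]
  · rcases Nat.even_or_odd p with h' | h'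
    · simp [h'.neg_one_pow]
    · simp [h'.neg_one_pow]

variable [Algebra ℂ A]

theorem rttDefect_eq_zero_iff (T : Fin 3 → Fin 3 → A⟦X⟧) : rttDefect T = 0 ↔
    tensMul (tensMul (rMatrix A) (tensFst fun i j => atU (T i j))) (tensSnd fun i j => atV (T i j))
    = tensMul (tensMul (tensSnd fun i j => atV (T i j)) (tensFst fun i j => atU (T i j)))
      (rMatrix A) := sub_eq_zero

theorem reorder {M : Type*} [Semigroup M] {R S₁ S₂ T₁ T₂ : M} (hS : R * S₁ * S₂ = S₂ * S₁ * R)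
    (hT : R * T₁ * T₂ = T₂ * T₁ * R) (h₁ : T₁ * S₂ = S₂ * T₁) (h₂ : S₁ * T₂ = T₂ * S₁) :
    R * (S₁ * T₁) * (S₂ * T₂) = S₂ * T₂ * (S₁ * T₁) * R := by
  calc R * (S₁ * T₁) * (S₂ * T₂) = R * S₁ * (T₁ * S₂) * T₂ := by simp only [mul_assoc]
    _ = R * S₁ * S₂ * (T₁ * T₂) := by rw [h₁]; simp only [mul_assoc]
    _ = S₂ * S₁ * (R * T₁ * T₂) := by rw [hS]; simp only [mul_assoc]
    _ = S₂ * (S₁ * T₂) * T₁ * R := by rw [hT]; simp only [mul_assoc]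
    _ = S₂ * T₂ * (S₁ * T₁) * R := by rw [h₂]; simp only [mul_assoc]

/-- The product of two mutually supercommuting solutions of the `RTT`-relation is a solution. -/
theorem rttDefect_mul (S T : Fin 3 → Fin 3 → A⟦X⟧) (hS : rttDefect S = 0) (hT : rttDefect T = 0)
    (h : ∀ i j k l m n, PowerSeries.coeff m (T i j) * PowerSeries.coeff n (S k l) =
      (-1) ^ ((par i + par j) * (par k + par l)) *
        (PowerSeries.coeff n (S k l) * PowerSeries.coeff m (T i j))) :
    rttDefect (fun i j => ∑ k, S i k * T k j) = 0 := by
  rw [rttDefect_eq_zero_iff] at *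
  simp only [map_sum, map_mul, ← tensMul_fst_fst, ← tensMul_snd_snd]
  let _ : Semigroup (Tens (A⟦X⟧⟦X⟧)) := { mul := tensMul, mul_assoc := tensMul_assoc }
  refine reorder (M := Tens (A⟦X⟧⟦X⟧)) hS hT ?_ ?_
  · refine tensMul_fst_snd _ _ fun i j k l => ?_
    ext m n
    rw [coeff_sign_mul, coeff_atU_mul_atV, coeff_atV_mul_atU, h]
  · refine tensMul_fst_snd _ _ fun i j k l => ?_
    ext m n
    rw [coeff_sign_mul, coeff_atU_mul_atV, coeff_atV_mul_atU, h, ← mul_assoc, ← pow_add,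
      neg_one_pow_congr' (n := 0), pow_zero, one_mul]
    intro R _ h2
    push_cast
    grind

theorem tensSign_rMatrix : tensSign (rMatrix A) = rMatrix A := by
  funext i j k l
  rcases Nat.even_or_odd (par i + par j + par k + par l) with h | h
  · simp [tensSign, h.neg_one_pow]
  · have : rMatrix A i j k l = 0 := by
      have h1 : ¬ (i = j ∧ k = l) := by
        rintro ⟨rfl, rfl⟩
        rw [← Nat.not_even_iff_odd] at h
        exact h ⟨par i + par k, by ring⟩
      have h2 : ¬ (k = j ∧ l = i) := by
        rintro ⟨rfl, rfl⟩
        rw [← Nat.not_even_iff_odd] at h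
        exact h ⟨par k + par l, by ring⟩
      have h3 : ¬ (k = i.rev ∧ l = j.rev) := by
        rintro ⟨rfl, rfl⟩
        rw [← Nat.not_even_iff_odd] at h
        have h4 : ∀ i, par (Fin.rev i) = par i := by decide
        rw [h4, h4] at h
        exact h ⟨par i + par j, by ring⟩
      simp [rMatrix, tensOne, tensP, tensQ, h1, h2, h3]
    simp [tensSign, this]

/-- The matrix `(-1)^{p(i)+p(j)} T_{ij}`. -/
def signMatrix (T : Fin 3 → Fin 3 → A⟦X⟧) (i j : Fin 3) : A⟦X⟧ := (-1) ^ (par i + par j) * T i j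

theorem rttDefect_sign (T : Fin 3 → Fin 3 → A⟦X⟧) (hT : rttDefect T = 0) :
    rttDefect (signMatrix T) = 0 := by
  rw [rttDefect_eq_zero_iff] at *
  have h1 : (tensFst fun i j => atU (signMatrix T i j)) =
      tensSign (tensFst fun i j => atU (T i j)) := by
    funext i j k l
    simp only [tensFst, tensSign, signMatrix, map_mul, map_pow, map_neg, map_one]
    split_ifs with hkl
    · subst hkl
      rw [← mul_assoc, ← mul_assoc, ← pow_add, ← pow_add]
      congr 1
      apply neg_one_pow_congr'
      intro R _ h2
      push_cast
      grind
    · simp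
  have h2 : (tensSnd fun i j => atV (signMatrix T i j)) =
      tensSign (tensSnd fun i j => atV (T i j)) := by
    funext i j k l
    simp only [tensSnd, tensSign, signMatrix, map_mul, map_pow, map_neg, map_one]
    split_ifs with hkl
    · subst hkl
      rw [← mul_assoc, ← mul_assoc, ← pow_add, ← pow_add]
      congr 1
      apply neg_one_pow_congr'
      intro R _ h2
      push_cast
      grind
    · simp
  rw [h1, h2]
  conv_lhs => rw [← tensSign_rMatrix]
  conv_rhs => rw [← tensSign_rMatrix]
  simp only [tensMul_sign, hT]

/-- A scalar series, viewed as a series with coefficients in `A`. -/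
def scalarSeries (A : Type*) [Ring A] [Algebra ℂ A] : ℂ⟦X⟧ →+* A⟦X⟧ :=
  PowerSeries.map (algebraMap ℂ A)

theorem scalarSeries_comm (φ : ℂ⟦X⟧) (a : A⟦X⟧) :
    scalarSeries A φ * a = a * scalarSeries A φ := by
  ext n
  rw [PowerSeries.coeff_mul, PowerSeries.coeff_mul, ← Finset.Nat.sum_antidiagonal_swap]
  refine Finset.sum_congr rfl fun p _ => ?_
  simp [scalarSeries, Algebra.commutes]

theorem atU_scalar_comm (φ : ℂ⟦X⟧) (x : A⟦X⟧⟦X⟧) :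
    atU (scalarSeries A φ) * x = x * atU (scalarSeries A φ) := by
  ext1 n
  rw [PowerSeries.coeff_mul, PowerSeries.coeff_mul, ← Finset.Nat.sum_antidiagonal_swap]
  refine Finset.sum_congr rfl fun p _ => ?_
  have : ∀ c : ℂ, PowerSeries.C (algebraMap ℂ A c) = scalarSeries A (PowerSeries.C c) := by
    intro c; simp [scalarSeries]
  simp only [atU, PowerSeries.coeff_map, Prod.fst_swap, Prod.snd_swap]
  simp only [scalarSeries, PowerSeries.coeff_map]
  rw [this, scalarSeries_comm]

theorem atV_scalar_comm (φ : ℂ⟦X⟧) (x : A⟦X⟧⟦X⟧) :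
    atV (scalarSeries A φ) * x = x * atV (scalarSeries A φ) := by
  ext1 n
  rw [atV, PowerSeries.coeff_C_mul, PowerSeries.coeff_mul_C, scalarSeries_comm]

theorem rttDefect_scalar (φ : ℂ⟦X⟧) (T : Fin 3 → Fin 3 → A⟦X⟧) (hT : rttDefect T = 0) :
    rttDefect (fun i j => scalarSeries A φ * T i j) = 0 := by
  rw [rttDefect_eq_zero_iff] at *
  have h1 : (tensFst fun i j => atU (scalarSeries A φ * T i j)) =
      fun i j k l => atU (scalarSeries A φ) * tensFst (fun i j => atU (T i j)) i j k l := by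
    funext i j k l
    simp only [tensFst, map_mul]
    split_ifs with hkl
    · rw [← mul_assoc, ← atU_scalar_comm, mul_assoc]
    · simp
  have h2 : (tensSnd fun i j => atV (scalarSeries A φ * T i j)) =
      fun i j k l => atV (scalarSeries A φ) * tensSnd (fun i j => atV (T i j)) i j k l := by
    funext i j k l
    simp only [tensSnd, map_mul]
    split_ifs with hkl
    · rw [← mul_assoc, ← atV_scalar_comm, mul_assoc]
    · simp
  rw [h1, h2]
  simp only [tensMul_smul_left,
    tensMul_smul_right (atU (scalarSeries A φ)) (atU_scalar_comm φ),
    tensMul_smul_right (atV (scalarSeries A φ)) (atV_scalar_comm φ), hT]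
  funext i j k l
  rw [← mul_assoc, ← mul_assoc, atU_scalar_comm]

end Solutions

/-! ### The superalgebra structure and the coproduct of the extended Yangian -/

/-- The parity automorphism of the extended Yangian: `t_{ij}^{(r)}` has parity `p(i) + p(j)`. -/
def parityX : ExtYangian →ₐ[ℂ] ExtYangian :=
  liftX (signMatrix tSeries) (by
    intro i j
    rw [signMatrix, map_mul, constantCoeff_tSeries]
    split_ifs with h
    · subst h
      simp [(Even.add_self (par i)).neg_one_pow]
    · simp) (rttDefect_sign _ rttDefect_tSeries)

theorem map_parityX (i j : Fin 3) :
    PowerSeries.map (parityX : ExtYangian →+* ExtYangian) (tSeries i j) =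
      (-1) ^ (par i + par j) * tSeries i j := map_liftX _ _ _ i j

theorem map_algHom_comp {A B C : Type*} [Ring A] [Ring B] [Ring C] [Algebra ℂ A] [Algebra ℂ B]
    [Algebra ℂ C] (g : B →ₐ[ℂ] C) (f : A →ₐ[ℂ] B) (a : A⟦X⟧) :
    PowerSeries.map (g.comp f : A →+* C) a =
      PowerSeries.map (g : B →+* C) (PowerSeries.map (f : A →+* B) a) := by
  ext n; simp

theorem map_algHom_id {A : Type*} [Ring A] [Algebra ℂ A] (a : A⟦X⟧) :
    PowerSeries.map (AlgHom.id ℂ A : A →+* A) a = a := by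
  ext n; simp

theorem parityX_parityX (x : ExtYangian) : parityX (parityX x) = x := by
  have : parityX.comp parityX = AlgHom.id ℂ ExtYangian := by
    apply extYangian_hom_ext
    intro i j
    rw [map_algHom_comp, map_algHom_id, map_parityX, map_mul, map_parityX, map_pow, map_neg,
      map_one, ← mul_assoc, ← pow_add, (Even.add_self _).neg_one_pow, one_mul]
  exact DFunLike.congr_fun this x

instance : GradedAlgebra (superPart parityX) := superGradedAlgebra parityX parityX_parityX

theorem coeff_tSeries_mem (i j : Fin 3) (n : ℕ) :
    PowerSeries.coeff n (tSeries i j) ∈ superPart parityX ((par i + par j : ℕ) : ZMod 2) := by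
  rw [mem_superPart, ZMod.val_natCast, ← neg_one_pow_eq_pow_mod_two]
  have h := congrArg (PowerSeries.coeff n) (map_parityX i j)
  rw [PowerSeries.coeff_map] at h
  refine h.trans ?_
  rcases Nat.even_or_odd (par i + par j) with h' | h'
  · simp [h'.neg_one_pow]
  · simp [h'.neg_one_pow]

/-- The tensor product `X(osp(1|2)) ⊗ X(osp(1|2))` of superalgebras, with the multiplication
`(a ⊗ b)(a' ⊗ b') = (-1)^{p(b)p(a')} aa' ⊗ bb'`. -/
abbrev ExtYangianSq : Type :=
  GradedTensorProduct ℂ (superPart parityX) (superPart parityX)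

/-- The element `a(u) ⊗ b(u) = ∑ (a_r ⊗ b_s) u^{-r-s}` for two series in `u⁻¹`. -/
def seriesTmul {A B : Type*} [Ring A] [Ring B] [Algebra ℂ A] [Algebra ℂ B]
    (𝒜 : ZMod 2 → Submodule ℂ A) (ℬ : ZMod 2 → Submodule ℂ B) [GradedAlgebra 𝒜] [GradedAlgebra ℬ]
    (a : A⟦X⟧) (b : B⟦X⟧) : (GradedTensorProduct ℂ 𝒜 ℬ)⟦X⟧ :=
  PowerSeries.mk fun n => ∑ p ∈ Finset.HasAntidiagonal.antidiagonal n,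
    GradedTensorProduct.tmul ℂ (PowerSeries.coeff p.1 a) (PowerSeries.coeff p.2 b)

section Graded

variable {A B : Type*} [Ring A] [Ring B] [Algebra ℂ A] [Algebra ℂ B]
  (𝒜 : ZMod 2 → Submodule ℂ A) (ℬ : ZMod 2 → Submodule ℂ B) [GradedAlgebra 𝒜] [GradedAlgebra ℬ]

theorem seriesTmul_eq (a : A⟦X⟧) (b : B⟦X⟧) : seriesTmul 𝒜 ℬ a b =
    PowerSeries.map (GradedTensorProduct.includeLeft 𝒜 ℬ : A →+* _) a *
      PowerSeries.map (GradedTensorProduct.includeRight 𝒜 ℬ : B →+* _) b := by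
  ext n
  rw [seriesTmul, PowerSeries.coeff_mk, PowerSeries.coeff_mul]
  refine Finset.sum_congr rfl fun p _ => ?_
  simp only [PowerSeries.coeff_map]
  exact (GradedTensorProduct.tmul_one_mul_one_tmul 𝒜 ℬ _ _).symm

theorem includeRight_mul_includeLeft {p q : ℕ} {a : A} {b : B} (ha : a ∈ 𝒜 (p : ZMod 2))
    (hb : b ∈ ℬ (q : ZMod 2)) :
    GradedTensorProduct.includeRight 𝒜 ℬ b * GradedTensorProduct.includeLeft 𝒜 ℬ a =
      (-1) ^ (q * p) *
        (GradedTensorProduct.includeLeft 𝒜 ℬ a * GradedTensorProduct.includeRight 𝒜 ℬ b) := by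
  have h := GradedTensorProduct.tmul_coe_mul_coe_tmul 𝒜 ℬ (1 : A) ⟨b, hb⟩ ⟨a, ha⟩ (1 : B)
  simp only [one_mul, mul_one] at h
  refine h.trans ?_
  rw [← Nat.cast_mul, uzpow_natCast]
  have h2 : GradedTensorProduct.includeLeft 𝒜 ℬ a * GradedTensorProduct.includeRight 𝒜 ℬ b =
    GradedTensorProduct.tmul ℂ a b := GradedTensorProduct.tmul_one_mul_one_tmul 𝒜 ℬ _ _
  rw [h2]
  rcases Nat.even_or_odd (q * p) with h' | h'
  · simp [h'.neg_one_pow]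
  · simp [h'.neg_one_pow]

/-- The tensor product `f ⊗ g` of two even homomorphisms of superalgebras. -/
def superMap {A' B' : Type*} [Ring A'] [Ring B'] [Algebra ℂ A'] [Algebra ℂ B']
    (𝒜' : ZMod 2 → Submodule ℂ A') (ℬ' : ZMod 2 → Submodule ℂ B')
    [GradedAlgebra 𝒜'] [GradedAlgebra ℬ'] (f : A →ₐ[ℂ] A') (g : B →ₐ[ℂ] B')
    (hf : ∀ i, ∀ a ∈ 𝒜 i, f a ∈ 𝒜' i) (hg : ∀ i, ∀ b ∈ ℬ i, g b ∈ ℬ' i) :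
    GradedTensorProduct ℂ 𝒜 ℬ →ₐ[ℂ] GradedTensorProduct ℂ 𝒜' ℬ' :=
  GradedTensorProduct.lift 𝒜 ℬ ((GradedTensorProduct.includeLeft 𝒜' ℬ').comp f)
    ((GradedTensorProduct.includeRight 𝒜' ℬ').comp g) (by
      intro i j a b
      have h := GradedTensorProduct.tmul_coe_mul_coe_tmul 𝒜' ℬ'
        (1 : A') ⟨_, hg j b b.2⟩ ⟨_, hf i a a.2⟩ (1 : B')
      simp only [one_mul, mul_one] at h
      have h2 := GradedTensorProduct.tmul_one_mul_one_tmul 𝒜' ℬ' (R := ℂ) (f a) (g b)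
      refine h2.trans ?_
      refine Eq.trans ?_ (congrArg _ h).symm
      rw [smul_smul, Int.units_mul_self, one_smul])

theorem superMap_of {A' B' : Type*} [Ring A'] [Ring B'] [Algebra ℂ A'] [Algebra ℂ B']
    (𝒜' : ZMod 2 → Submodule ℂ A') (ℬ' : ZMod 2 → Submodule ℂ B')
    [GradedAlgebra 𝒜'] [GradedAlgebra ℬ'] (f : A →ₐ[ℂ] A') (g : B →ₐ[ℂ] B')
    (hf : ∀ i, ∀ a ∈ 𝒜 i, f a ∈ 𝒜' i) (hg : ∀ i, ∀ b ∈ ℬ i, g b ∈ ℬ' i) (z : A ⊗[ℂ] B) :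
    superMap 𝒜 ℬ 𝒜' ℬ' f g hf hg (GradedTensorProduct.of ℂ 𝒜 ℬ z) =
      GradedTensorProduct.of ℂ 𝒜' ℬ' (TensorProduct.map f.toLinearMap g.toLinearMap z) := by
  induction z using TensorProduct.induction_on with
  | zero => simp
  | tmul a b => exact GradedTensorProduct.tmul_one_mul_one_tmul 𝒜' ℬ' (R := ℂ) (f a) (g b)
  | add x y hx hy => simp only [map_add, hx, hy]

theorem map_superMap {A' B' : Type*} [Ring A'] [Ring B'] [Algebra ℂ A'] [Algebra ℂ B']
    (𝒜' : ZMod 2 → Submodule ℂ A') (ℬ' : ZMod 2 → Submodule ℂ B')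
    [GradedAlgebra 𝒜'] [GradedAlgebra ℬ'] (f : A →ₐ[ℂ] A') (g : B →ₐ[ℂ] B')
    (hf : ∀ i, ∀ a ∈ 𝒜 i, f a ∈ 𝒜' i) (hg : ∀ i, ∀ b ∈ ℬ i, g b ∈ ℬ' i) (a : A⟦X⟧) (b : B⟦X⟧) :
    PowerSeries.map (superMap 𝒜 ℬ 𝒜' ℬ' f g hf hg : GradedTensorProduct ℂ 𝒜 ℬ →+* _)
        (seriesTmul 𝒜 ℬ a b) =
      seriesTmul 𝒜' ℬ' (PowerSeries.map (f : A →+* A') a) (PowerSeries.map (g : B →+* B') b) := by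
  ext n
  rw [PowerSeries.coeff_map, seriesTmul, PowerSeries.coeff_mk, map_sum, seriesTmul,
    PowerSeries.coeff_mk]
  refine Finset.sum_congr rfl fun p _ => ?_
  exact superMap_of 𝒜 ℬ 𝒜' ℬ' f g hf hg _

end Graded

/-- The coproduct `Δ : t_{ij}(u) ↦ ∑_k t_{ik}(u) ⊗ t_{kj}(u)` of the extended Yangian. -/
def coproductX : ExtYangian →ₐ[ℂ] ExtYangianSq :=
  liftX (fun i j => ∑ k, seriesTmul (superPart parityX) (superPart parityX)
      (tSeries i k) (tSeries k j)) (by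
    intro i j
    simp only [seriesTmul_eq, map_sum, map_mul, ← PowerSeries.coeff_zero_eq_constantCoeff_apply,
      PowerSeries.coeff_map]
    simp only [PowerSeries.coeff_zero_eq_constantCoeff_apply, constantCoeff_tSeries, apply_ite,
      map_one, map_zero]
    fin_cases i <;> fin_cases j <;> simp) (by
    simp only [seriesTmul_eq]
    refine rttDefect_mul _ _ ?_ ?_ ?_
    · funext i j k l
      rw [← map₂_rttDefect, rttDefect_tSeries]; simp
    · funext i j k l
      rw [← map₂_rttDefect, rttDefect_tSeries]; simp
    · intro i j k l m n
      simp only [PowerSeries.coeff_map]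
      exact includeRight_mul_includeLeft _ _ (coeff_tSeries_mem k l n) (coeff_tSeries_mem i j m))

theorem map_coproductX (i j : Fin 3) :
    PowerSeries.map (coproductX : ExtYangian →+* ExtYangianSq) (tSeries i j) =
      ∑ k, seriesTmul (superPart parityX) (superPart parityX) (tSeries i k) (tSeries k j) :=
  map_liftX _ _ _ i j

/-! ### The Yangian -/

/-- The automorphism `t_{ij}(u) ↦ φ(u) t_{ij}(u)` for `φ(u) ∈ 1 + u⁻¹ ℂ[[u⁻¹]]`. -/
def mulAut (φ : {φ : ℂ⟦X⟧ // PowerSeries.constantCoeff φ = 1}) : ExtYangian →ₐ[ℂ] ExtYangian :=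
  liftX (fun i j => scalarSeries ExtYangian φ.1 * tSeries i j) (by
    intro i j
    rw [map_mul, constantCoeff_tSeries]
    have : PowerSeries.constantCoeff (scalarSeries ExtYangian φ.1) = 1 := by
      rw [scalarSeries, ← PowerSeries.coeff_zero_eq_constantCoeff_apply, PowerSeries.coeff_map,
        PowerSeries.coeff_zero_eq_constantCoeff_apply, φ.2, map_one]
    rw [this, one_mul]) (rttDefect_scalar _ _ rttDefect_tSeries)

theorem map_mulAut (φ : {φ : ℂ⟦X⟧ // PowerSeries.constantCoeff φ = 1}) (i j : Fin 3) :
    PowerSeries.map (mulAut φ : ExtYangian →+* ExtYangian) (tSeries i j) =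
      scalarSeries ExtYangian φ.1 * tSeries i j := map_liftX _ _ _ i j

/-- The Yangian `Y(osp(1|2))`: the subalgebra of the elements stable under all automorphisms
`t_{ij}(u) ↦ φ(u) t_{ij}(u)`. -/
def Yangian : Subalgebra ℂ ExtYangian where
  carrier := {x | ∀ φ, mulAut φ x = x}
  mul_mem' := by
    intro a b ha hb φ
    rw [map_mul, ha φ, hb φ]
  add_mem' := by
    intro a b ha hb φ
    rw [map_add, ha φ, hb φ]
  algebraMap_mem' := by
    intro c φ
    exact AlgHom.commutes _ c

theorem mem_yangian {x : ExtYangian} : x ∈ Yangian ↔ ∀ φ, mulAut φ x = x := Iff.rfl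

theorem map_scalarSeries {A B : Type*} [Ring A] [Algebra ℂ A] [Ring B] [Algebra ℂ B]
    (f : A →ₐ[ℂ] B) (φ : ℂ⟦X⟧) :
    PowerSeries.map (f : A →+* B) (scalarSeries A φ) = scalarSeries B φ := by
  ext n
  simp [scalarSeries]

theorem parityX_mulAut (φ : {φ : ℂ⟦X⟧ // PowerSeries.constantCoeff φ = 1}) (x : ExtYangian) :
    parityX (mulAut φ x) = mulAut φ (parityX x) := by
  have : parityX.comp (mulAut φ) = (mulAut φ).comp parityX := by
    apply extYangian_hom_ext
    intro i j
    rw [map_algHom_comp, map_algHom_comp, map_mulAut, map_mul, map_parityX, map_mul, map_mulAut,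
      map_scalarSeries, map_pow, map_neg, map_one, ← mul_assoc, scalarSeries_comm, mul_assoc]
  exact DFunLike.congr_fun this x

/-- The parity automorphism of the Yangian. -/
def parityY : Yangian →ₐ[ℂ] Yangian :=
  AlgHom.codRestrict (parityX.comp Yangian.val) Yangian (by
    intro x φ
    have h : mulAut φ x = (x : ExtYangian) := x.2 φ
    change mulAut φ (parityX x) = parityX x
    rw [← parityX_mulAut, h])

theorem coe_parityY (x : Yangian) : (parityY x : ExtYangian) = parityX x := rfl

theorem parityY_parityY (x : Yangian) : parityY (parityY x) = x :=
  Subtype.ext (parityX_parityX x)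

instance : GradedAlgebra (superPart parityY) := superGradedAlgebra parityY parityY_parityY

/-- The tensor product `Y(osp(1|2)) ⊗ Y(osp(1|2))` of superalgebras. -/
abbrev YangianSq : Type :=
  GradedTensorProduct ℂ (superPart parityY) (superPart parityY)

theorem coe_mem_superPart (i : ZMod 2) (a : Yangian) (ha : a ∈ superPart parityY i) :
    Yangian.val a ∈ superPart parityX i := by
  rw [mem_superPart] at ha ⊢
  exact (coe_parityY a).symm.trans (congrArg _ ha)

/-- The embedding of `Y ⊗ Y` into `X ⊗ X`. -/
def inclSq : YangianSq →ₐ[ℂ] ExtYangianSq :=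
  superMap (superPart parityY) (superPart parityY) (superPart parityX) (superPart parityX)
    Yangian.val Yangian.val coe_mem_superPart coe_mem_superPart

theorem inclSq_of (z : Yangian ⊗[ℂ] Yangian) :
    inclSq (GradedTensorProduct.of ℂ (superPart parityY) (superPart parityY) z) =
      GradedTensorProduct.of ℂ (superPart parityX) (superPart parityX)
        (TensorProduct.map Yangian.val.toLinearMap Yangian.val.toLinearMap z) :=
  superMap_of _ _ _ _ _ _ _ _ z

theorem inclSq_injective : Function.Injective inclSq := by
  intro x y h
  have hi : Function.Injective Yangian.val.toLinearMap := Subtype.val_injective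
  have hm : Function.Injective
      (TensorProduct.map Yangian.val.toLinearMap Yangian.val.toLinearMap) :=
    TensorProduct.map_injective_of_flat_flat _ _ hi hi
  exact hm (((inclSq_of x).symm.trans h).trans (inclSq_of y))

section Invariants

variable {I V W : Type*} [AddCommGroup V] [Module ℂ V] [AddCommGroup W] [Module ℂ W]

theorem exists_rTensor (f : I → V →ₗ[ℂ] V) (K : Submodule ℂ V) (hK : ∀ x, x ∈ K ↔ ∀ a, f a x = x)
    (z : V ⊗[ℂ] W) (hz : ∀ a, (f a).rTensor W z = z) : ∃ w, K.subtype.rTensor W w = z := by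
  let b := Module.Basis.ofVectorSpace ℂ W
  obtain ⟨c, hc⟩ := TensorProduct.eq_repr_basis_right b z
  have hmem : ∀ i, c i ∈ K := by
    classical
    intro i
    rw [hK]
    intro a
    have h1 := hz a
    rw [← hc, Finsupp.sum, map_sum] at h1
    simp only [LinearMap.rTensor_tmul] at h1
    have h2 := congrArg (fun t => (TensorProduct.equivFinsuppOfBasisRight b) t i) h1
    have h3 : ∀ (g : Module.Basis.ofVectorSpaceIndex ℂ W → V),
        (TensorProduct.equivFinsuppOfBasisRight b) (∑ j ∈ c.support, g j ⊗ₜ[ℂ] b j) i =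
          ∑ j ∈ c.support, if j = i then g j else 0 := by
      intro g
      rw [map_sum, Finsupp.finsetSum_apply]
      refine Finset.sum_congr rfl fun j _ => ?_
      simp [Finsupp.single_apply]
    simp only [h3] at h2
    rw [Finset.sum_ite_eq', Finset.sum_ite_eq'] at h2
    by_cases hi : i ∈ c.support
    · simpa [hi] using h2
    · simp [Finsupp.notMem_support_iff.mp hi]
  refine ⟨∑ i ∈ c.support, (⟨c i, hmem i⟩ : K) ⊗ₜ[ℂ] b i, ?_⟩
  rw [map_sum]
  simpa [Finsupp.sum] using hc

theorem exists_lTensor (f : I → V →ₗ[ℂ] V) (K : Submodule ℂ V) (hK : ∀ x, x ∈ K ↔ ∀ a, f a x = x)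
    (z : W ⊗[ℂ] V) (hz : ∀ a, (f a).lTensor W z = z) : ∃ w, K.subtype.lTensor W w = z := by
  obtain ⟨w, hw⟩ := exists_rTensor f K hK (TensorProduct.comm ℂ W V z) (by
    intro a
    rw [LinearMap.rTensor_comm, hz a])
  refine ⟨TensorProduct.comm ℂ K W w, ?_⟩
  rw [LinearMap.lTensor_comm, hw]
  simp

end Invariants

theorem id_mem_superPart (i : ZMod 2) (a : ExtYangian) (ha : a ∈ superPart parityX i) :
    AlgHom.id ℂ ExtYangian a ∈ superPart parityX i := ha

theorem mulAut_mem_superPart (φ : {φ : ℂ⟦X⟧ // PowerSeries.constantCoeff φ = 1}) (i : ZMod 2)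
    (a : ExtYangian) (ha : a ∈ superPart parityX i) : mulAut φ a ∈ superPart parityX i := by
  rw [mem_superPart] at ha ⊢
  rw [parityX_mulAut, ha, map_smul]

theorem seriesTmul_scalar_left {A B : Type*} [Ring A] [Ring B] [Algebra ℂ A] [Algebra ℂ B]
    (𝒜 : ZMod 2 → Submodule ℂ A) (ℬ : ZMod 2 → Submodule ℂ B) [GradedAlgebra 𝒜] [GradedAlgebra ℬ]
    (φ : ℂ⟦X⟧) (a : A⟦X⟧) (b : B⟦X⟧) : seriesTmul 𝒜 ℬ (scalarSeries A φ * a) b =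
      scalarSeries _ φ * seriesTmul 𝒜 ℬ a b := by
  rw [seriesTmul_eq, seriesTmul_eq, map_mul, map_scalarSeries, mul_assoc]

theorem seriesTmul_scalar_right {A B : Type*} [Ring A] [Ring B] [Algebra ℂ A] [Algebra ℂ B]
    (𝒜 : ZMod 2 → Submodule ℂ A) (ℬ : ZMod 2 → Submodule ℂ B) [GradedAlgebra 𝒜] [GradedAlgebra ℬ]
    (φ : ℂ⟦X⟧) (a : A⟦X⟧) (b : B⟦X⟧) : seriesTmul 𝒜 ℬ a (scalarSeries B φ * b) =
      scalarSeries _ φ * seriesTmul 𝒜 ℬ a b := by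
  rw [seriesTmul_eq, seriesTmul_eq, map_mul, map_scalarSeries, ← mul_assoc, ← scalarSeries_comm,
    mul_assoc]

theorem coproductX_mulAut_left (φ : {φ : ℂ⟦X⟧ // PowerSeries.constantCoeff φ = 1})
    (x : ExtYangian) : coproductX (mulAut φ x) =
      superMap (superPart parityX) (superPart parityX) (superPart parityX) (superPart parityX)
        (mulAut φ) (AlgHom.id ℂ _) (mulAut_mem_superPart φ) id_mem_superPart (coproductX x) := by
  refine DFunLike.congr_fun (f := coproductX.comp (mulAut φ)) (g := AlgHom.comp
    (superMap (superPart parityX) (superPart parityX) (superPart parityX) (superPart parityX)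
        (mulAut φ) (AlgHom.id ℂ _) (mulAut_mem_superPart φ) id_mem_superPart) coproductX) ?_ x
  apply extYangian_hom_ext
  intro i j
  rw [map_algHom_comp, map_algHom_comp, map_mulAut, map_mul, map_coproductX, map_scalarSeries,
    map_sum]
  simp only [map_superMap, map_mulAut, map_algHom_id, seriesTmul_scalar_left, Finset.mul_sum]

theorem coproductX_mulAut_right (φ : {φ : ℂ⟦X⟧ // PowerSeries.constantCoeff φ = 1})
    (x : ExtYangian) : coproductX (mulAut φ x) =
      superMap (superPart parityX) (superPart parityX) (superPart parityX) (superPart parityX)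
        (AlgHom.id ℂ _) (mulAut φ) id_mem_superPart (mulAut_mem_superPart φ) (coproductX x) := by
  refine DFunLike.congr_fun (f := coproductX.comp (mulAut φ)) (g := AlgHom.comp
    (superMap (superPart parityX) (superPart parityX) (superPart parityX) (superPart parityX)
        (AlgHom.id ℂ _) (mulAut φ) id_mem_superPart (mulAut_mem_superPart φ)) coproductX) ?_ x
  apply extYangian_hom_ext
  intro i j
  rw [map_algHom_comp, map_algHom_comp, map_mulAut, map_mul, map_coproductX, map_scalarSeries,
    map_sum]
  simp only [map_superMap, map_mulAut, map_algHom_id, seriesTmul_scalar_right, Finset.mul_sum]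

theorem coproductX_mem_range (x : Yangian) : coproductX x ∈ inclSq.range := by
  let z : ExtYangian ⊗[ℂ] ExtYangian :=
    (GradedTensorProduct.of ℂ (superPart parityX) (superPart parityX)).symm (coproductX x)
  have hz : coproductX x = GradedTensorProduct.of ℂ (superPart parityX) (superPart parityX) z := rfl
  have hl : ∀ φ, (mulAut φ).toLinearMap.rTensor ExtYangian z = z := by
    intro φ
    have h := coproductX_mulAut_left φ x
    rw [x.2 φ, hz, superMap_of] at h
    exact h.symm
  have hr : ∀ φ, (mulAut φ).toLinearMap.lTensor ExtYangian z = z := by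
    intro φ
    have h := coproductX_mulAut_right φ x
    rw [x.2 φ, hz, superMap_of] at h
    exact h.symm
  obtain ⟨w, hw⟩ := exists_rTensor (fun φ => (mulAut φ).toLinearMap) (Subalgebra.toSubmodule Yangian)
    (fun x => mem_yangian) z hl
  obtain ⟨t, ht⟩ := exists_lTensor (fun φ => (mulAut φ).toLinearMap) (Subalgebra.toSubmodule Yangian)
    (fun x => mem_yangian) w (by
      intro φ
      apply Module.Flat.rTensor_preserves_injective_linearMap
        (Subalgebra.toSubmodule Yangian).subtype Subtype.val_injective
      rw [hw, ← LinearMap.comp_apply, LinearMap.rTensor_comp_lTensor,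
        ← LinearMap.lTensor_comp_rTensor, LinearMap.comp_apply, hw]
      exact hr φ)
  refine ⟨GradedTensorProduct.of ℂ (superPart parityY) (superPart parityY) t, ?_⟩
  refine (inclSq_of t).trans ?_
  rw [hz, ← hw, ← ht, ← LinearMap.comp_apply, LinearMap.rTensor_comp_lTensor]
  rfl

/-- The coproduct of the Yangian: the restriction of the coproduct of the extended Yangian, which
maps `Y` to `Y ⊗ Y`. -/
def coproductY : Yangian →ₐ[ℂ] YangianSq :=
  (AlgEquiv.ofInjective inclSq inclSq_injective).symm.toAlgHom.comp
    (AlgHom.codRestrict (coproductX.comp Yangian.val) inclSq.range coproductX_mem_range)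

theorem inclSq_coproductY (x : Yangian) : inclSq (coproductY x) = coproductX x :=
  congrArg Subtype.val ((AlgEquiv.ofInjective inclSq inclSq_injective).apply_symm_apply
    ⟨coproductX x, coproductX_mem_range x⟩)

/-! ### Gaussian generators -/

/-- The inverse of a series in `u⁻¹` with constant term `1`. -/
def invSeries {A : Type*} [Ring A] (a : A⟦X⟧) : A⟦X⟧ := PowerSeries.invOfUnit a 1

theorem mul_invSeries {A : Type*} [Ring A] (a : A⟦X⟧) (h : PowerSeries.constantCoeff a = 1) :
    a * invSeries a = 1 := PowerSeries.mul_invOfUnit a 1 h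

theorem invSeries_mul {A : Type*} [Ring A] (a : A⟦X⟧) (h : PowerSeries.constantCoeff a = 1) :
    invSeries a * a = 1 := PowerSeries.invOfUnit_mul a 1 h

/-- `h₁(u) = t₁₁(u)`. -/
def h₁X : ExtYangian⟦X⟧ := tSeries 0 0

/-- `h₂(u) = t₂₂(u) - t₂₁(u) t₁₁(u)⁻¹ t₁₂(u)`. -/
def h₂X : ExtYangian⟦X⟧ := tSeries 1 1 - tSeries 1 0 * invSeries (tSeries 0 0) * tSeries 0 1

/-- `k(u) = h₁(u)⁻¹ h₂(u)`. -/
def kX : ExtYangian⟦X⟧ := invSeries h₁X * h₂X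

/-- `e_{1j}(u) = h₁(u)⁻¹ t_{1j}(u)` for `j = 2, 1'`. -/
def eX (j : Fin 3) : ExtYangian⟦X⟧ := invSeries h₁X * tSeries 0 j

/-- `f_{j1}(u) = t_{j1}(u) h₁(u)⁻¹` for `j = 2, 1'`. -/
def fX (j : Fin 3) : ExtYangian⟦X⟧ := tSeries j 0 * invSeries h₁X

theorem constantCoeff_h₁X : PowerSeries.constantCoeff h₁X = 1 := by
  rw [h₁X, constantCoeff_tSeries, if_pos rfl]

theorem invSeries_unique {A : Type*} [Ring A] {a b : A⟦X⟧}
    (h : PowerSeries.constantCoeff a = 1) (hab : b * a = 1) : invSeries a = b := by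
  rw [← one_mul (invSeries a), ← hab, mul_assoc, mul_invSeries a h, mul_one]

theorem constantCoeff_scalarSeries (φ : {φ : ℂ⟦X⟧ // PowerSeries.constantCoeff φ = 1}) :
    PowerSeries.constantCoeff (scalarSeries ExtYangian φ.1) = 1 := by
  rw [scalarSeries, ← PowerSeries.coeff_zero_eq_constantCoeff_apply, PowerSeries.coeff_map,
    PowerSeries.coeff_zero_eq_constantCoeff_apply, φ.2, map_one]

theorem map_mulAut_invSeries (φ : {φ : ℂ⟦X⟧ // PowerSeries.constantCoeff φ = 1}) :
    PowerSeries.map (mulAut φ : ExtYangian →+* ExtYangian) (invSeries h₁X) *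
      scalarSeries ExtYangian φ.1 = invSeries h₁X := by
  refine (invSeries_unique constantCoeff_h₁X ?_).symm
  have h := map_mulAut φ 0 0
  rw [mul_assoc]
  have h2 : scalarSeries ExtYangian φ.1 * h₁X =
    PowerSeries.map (mulAut φ : ExtYangian →+* ExtYangian) h₁X := h.symm
  rw [h2, ← map_mul, invSeries_mul _ constantCoeff_h₁X, map_one]

theorem coeff_mem_yangian {a : ExtYangian⟦X⟧}
    (h : ∀ φ, PowerSeries.map (mulAut φ : ExtYangian →+* ExtYangian) a = a) (n : ℕ) :
    PowerSeries.coeff n a ∈ Yangian := by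
  intro φ
  have := congrArg (PowerSeries.coeff n) (h φ)
  rwa [PowerSeries.coeff_map] at this

theorem coeff_eX_mem (j : Fin 3) (n : ℕ) : PowerSeries.coeff n (eX j) ∈ Yangian := by
  refine coeff_mem_yangian (fun φ => ?_) n
  rw [eX, map_mul, map_mulAut, ← mul_assoc, map_mulAut_invSeries]

theorem coeff_fX_mem (j : Fin 3) (n : ℕ) : PowerSeries.coeff n (fX j) ∈ Yangian := by
  refine coeff_mem_yangian (fun φ => ?_) n
  rw [fX, map_mul, map_mulAut, scalarSeries_comm, mul_assoc, scalarSeries_comm,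
    map_mulAut_invSeries]

theorem coeff_kX_mem (n : ℕ) : PowerSeries.coeff n kX ∈ Yangian := by
  refine coeff_mem_yangian (fun φ => ?_) n
  have h : PowerSeries.map (mulAut φ : ExtYangian →+* ExtYangian) h₂X =
      scalarSeries ExtYangian φ.1 * h₂X := by
    have h3 := map_mulAut_invSeries φ
    rw [h₁X] at h3
    rw [h₂X, map_sub, map_mul, map_mul, map_mulAut, map_mulAut, map_mulAut, mul_sub]
    conv_rhs => rw [← h3]
    simp only [mul_assoc]
  rw [kX, map_mul, h, ← mul_assoc, map_mulAut_invSeries]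

/-- A series over `X` whose coefficients lie in `Y`, viewed as a series over `Y`. -/
def toY (a : ExtYangian⟦X⟧) (h : ∀ n, PowerSeries.coeff n a ∈ Yangian) : Yangian⟦X⟧ :=
  PowerSeries.mk fun n => ⟨PowerSeries.coeff n a, h n⟩

/-- The series `k(u)` over the Yangian. -/
def kY : Yangian⟦X⟧ := toY kX coeff_kX_mem

/-- The series `e(u) = e_{12}(u)` over the Yangian. -/
def eY : Yangian⟦X⟧ := toY (eX 1) (coeff_eX_mem 1)

/-- The series `e_{11'}(u)` over the Yangian. -/
def e₁₁Y : Yangian⟦X⟧ := toY (eX 2) (coeff_eX_mem 2)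

/-- The series `f(u) = f_{21}(u)` over the Yangian. -/
def fY : Yangian⟦X⟧ := toY (fX 1) (coeff_fX_mem 1)

/-- The series `f_{1'1}(u)` over the Yangian. -/
def f₁₁Y : Yangian⟦X⟧ := toY (fX 2) (coeff_fX_mem 2)

/-- The series `a(u + c)` re-expanded in `u⁻¹`: each `u^{-r}` is replaced by
`(u + c)^{-r} = (u⁻¹ (1 + c u⁻¹)⁻¹)^r`, which has no terms of degree less than `r` in `u⁻¹`. -/
def shift {A : Type*} [Ring A] [Algebra ℂ A] (c : ℂ) (a : A⟦X⟧) : A⟦X⟧ := PowerSeries.mk fun n =>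
  ∑ r ∈ Finset.range (n + 1),
    PowerSeries.coeff n ((PowerSeries.X * (1 + PowerSeries.C c * PowerSeries.X)⁻¹ : ℂ⟦X⟧) ^ r) •
      PowerSeries.coeff r a

/-- The series `∑_{r ≥ 0} a_r` of formal power series converges to `s`: every coefficient of the
partial sums is eventually equal to that of `s`. -/
def HasFormalSum {A : Type*} [Ring A] (a : ℕ → A⟦X⟧) (s : A⟦X⟧) : Prop :=
  ∀ n, ∃ N, ∀ M ≥ N, PowerSeries.coeff n (∑ r ∈ Finset.range M, a r) = PowerSeries.coeff n s

/-- The image under the coproduct of a series over the Yangian, taken coefficientwise. -/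
def deltaSeries (a : Yangian⟦X⟧) : YangianSq⟦X⟧ :=
  PowerSeries.map (coproductY : Yangian →+* YangianSq) a

/-- The series `a(u) ⊗ b(u)` over `Y ⊗ Y`. -/
def tmulY (a b : Yangian⟦X⟧) : YangianSq⟦X⟧ :=
  seriesTmul (superPart parityY) (superPart parityY) a b

end OspYangian

end

open OspYangian

/-!
Setting `u - v = -1` in the defining relation gives `h₁(u) f(u + 1) = t₂₁(u)` and
`h₁(u) (f_{1'1}(u + 1) - 2 f(u + 1)²) = t_{1'1}(u)`, and hence `Δ(h₁(u)) = (h₁(u) ⊗ h₁(u)) (1 + W)`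
where `W` is the series whose geometric series occurs in `Δ(e(u))`. Multiplying
`Δ(e(u)) - 1 ⊗ e(u)` by `Δ(h₁(u))`, the remaining terms are evaluated with the specialisations
`u - v = κ` and `u - v = 1/2`. These identities live in the tensor square of the extended Yangian,
where `h₁` is available, and descend to `Y ⊗ Y` by injectivity of the inclusion. The formula for
`Δ(f(u))` is obtained in the same way, with the factors in the opposite order.
-/

noncomputable section

namespace OspYangian

open PowerSeries

theorem constantCoeff_map {R S : Type*} [Semiring R] [Semiring S] (f : R →+* S) (φ : R⟦X⟧) :
    constantCoeff (map f φ) = f (constantCoeff φ) := by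
  rw [← coeff_zero_eq_constantCoeff_apply, coeff_map, coeff_zero_eq_constantCoeff_apply]

section Evaluation

variable {A : Type*} [Ring A] {p : A⟦X⟧}

theorem coeff_mul_pow_of_lt (hp : constantCoeff p = 0) (a : A⟦X⟧) {n m : ℕ} (h : n < m) :
    coeff n (a * p ^ m) = 0 :=
  coeff_of_lt_order n <| calc
    (n : ℕ∞) < m := by exact_mod_cast h
    _ ≤ (p ^ m).order := le_order_pow_of_constantCoeff_eq_zero m hp
    _ ≤ a.order + (p ^ m).order := le_add_self
    _ ≤ (a * p ^ m).order := le_order_mul ..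

theorem coeff_eval_eq_zero (hp : constantCoeff p = 0) {P : Polynomial A⟦X⟧} {n : ℕ}
    (hP : ∀ m ≤ n, P.coeff m = 0) : coeff n (P.eval p) = 0 := by
  rw [Polynomial.eval_eq_sum, Polynomial.sum, map_sum]
  refine Finset.sum_eq_zero fun m _ => ?_
  rcases le_or_gt m n with h | h
  · rw [hP m h, zero_mul, map_zero]
  · exact coeff_mul_pow_of_lt hp _ h

/-- The value `∑ m, F_m * p ^ m` of a power series `F = ∑ m, F_m * X ^ m` at a series `p`,
meaningful when `p` has no constant term. -/
def evalSeries (p : A⟦X⟧) (F : A⟦X⟧⟦X⟧) : A⟦X⟧ :=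
  mk fun n => coeff n ((trunc (n + 1) F).eval p)

theorem coeff_evalSeries (hp : constantCoeff p = 0) {F : A⟦X⟧⟦X⟧} {P : Polynomial A⟦X⟧} {n : ℕ}
    (hP : ∀ m ≤ n, P.coeff m = coeff m F) : coeff n (evalSeries p F) = coeff n (P.eval p) := by
  rw [evalSeries, coeff_mk, ← sub_eq_zero, ← map_sub, ← Polynomial.eval_sub]
  refine coeff_eval_eq_zero hp fun m hm => ?_
  rw [Polynomial.coeff_sub, coeff_trunc, if_pos (Nat.lt_succ_of_le hm), hP m hm, sub_self]

theorem evalSeries_C (p a : A⟦X⟧) : evalSeries p (C a) = a := by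
  ext n
  rw [evalSeries, coeff_mk, trunc_C, Polynomial.eval_C]

theorem evalSeries_X (hp : constantCoeff p = 0) : evalSeries p X = p := by
  ext n
  rw [coeff_evalSeries (P := Polynomial.X) hp fun m _ => ?_, Polynomial.eval_X]
  rw [← Polynomial.coeff_coe, Polynomial.coe_X]

theorem evalSeries_add (p : A⟦X⟧) (F G : A⟦X⟧⟦X⟧) :
    evalSeries p (F + G) = evalSeries p F + evalSeries p G := by
  ext n
  simp only [evalSeries, coeff_mk, map_add, Polynomial.eval_add]

theorem evalSeries_mul (hp : constantCoeff p = 0) (hcomm : ∀ a, Commute a p) (F G : A⟦X⟧⟦X⟧) :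
    evalSeries p (F * G) = evalSeries p F * evalSeries p G := by
  ext n
  have htrunc {H : A⟦X⟧⟦X⟧} {m : ℕ} (hm : m ≤ n) : (trunc (n + 1) H).coeff m = coeff m H := by
    rw [coeff_trunc, if_pos (Nat.lt_succ_of_le hm)]
  have heval : ((trunc (n + 1) F * trunc (n + 1) G).eval p) =
      (trunc (n + 1) F).eval p * (trunc (n + 1) G).eval p :=
    Polynomial.eval₂_mul_noncomm _ _ fun k => hcomm _
  rw [coeff_evalSeries (P := trunc (n + 1) F * trunc (n + 1) G) hp fun m hm => ?_, heval,
    coeff_mul, coeff_mul]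
  · refine Finset.sum_congr rfl fun i hi => ?_
    have h₁ := Finset.HasAntidiagonal.antidiagonal.fst_le hi
    have h₂ := Finset.HasAntidiagonal.antidiagonal.snd_le hi
    rw [coeff_evalSeries hp fun m hm => htrunc (hm.trans h₁),
      coeff_evalSeries hp fun m hm => htrunc (hm.trans h₂)]
  · rw [Polynomial.coeff_mul, coeff_mul]
    refine Finset.sum_congr rfl fun i hi => ?_
    rw [htrunc ((Finset.HasAntidiagonal.antidiagonal.fst_le hi).trans hm),
      htrunc ((Finset.HasAntidiagonal.antidiagonal.snd_le hi).trans hm)]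

/-- Evaluation of the outer variable at a central series without constant term. -/
def evalHom [Algebra ℂ A] (p : A⟦X⟧) (hp : constantCoeff p = 0) (hcomm : ∀ a, Commute a p) :
    A⟦X⟧⟦X⟧ →ₐ[ℂ] A⟦X⟧ where
  toFun := evalSeries p
  map_one' := evalSeries_C p 1
  map_zero' := by rw [← map_zero C, evalSeries_C]
  map_add' := evalSeries_add p
  map_mul' := evalSeries_mul hp hcomm
  commutes' c := by rw [PowerSeries.algebraMap_apply, evalSeries_C]

end Evaluation

section Shift

variable {A : Type*} [Ring A] [Algebra ℂ A]

/-- The expansion `(u + c)⁻¹ = u⁻¹ (1 + c u⁻¹)⁻¹`. -/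
def shiftInv (c : ℂ) : ℂ⟦X⟧ := X * (1 + C c * X)⁻¹

theorem shiftInv_mul (c : ℂ) : shiftInv c * (1 + C c * X) = X := by
  rw [shiftInv, mul_assoc, PowerSeries.inv_mul_cancel _ (by simp), mul_one]

theorem constantCoeff_shiftInv (c : ℂ) : constantCoeff (shiftInv c) = 0 := by
  simp [shiftInv]

theorem shiftInv_sub (a b : ℂ) :
    shiftInv b - shiftInv a = C (a - b) * (shiftInv a * shiftInv b) := by
  have hb : (shiftInv b - shiftInv a - C (a - b) * (shiftInv a * shiftInv b)) * X = 0 := by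
    rw [map_sub]
    linear_combination shiftInv a * shiftInv_mul b - shiftInv b * shiftInv_mul a
  exact sub_eq_zero.mp ((mul_eq_zero.mp hb).resolve_right X_ne_zero)

theorem constantCoeff_scalarSeries_shiftInv (c : ℂ) :
    constantCoeff (scalarSeries A (shiftInv c)) = 0 := by
  rw [scalarSeries, constantCoeff_map, constantCoeff_shiftInv, map_zero]

variable (A) in
/-- Evaluation of the outer variable `u⁻¹` at `(u + c)⁻¹`. -/
def evalShift (c : ℂ) : A⟦X⟧⟦X⟧ →ₐ[ℂ] A⟦X⟧ :=
  evalHom (scalarSeries A (shiftInv c)) (constantCoeff_scalarSeries_shiftInv c)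
    fun a => (scalarSeries_comm _ a).symm

theorem evalShift_C (c : ℂ) (a : A⟦X⟧) : evalShift A c (C a) = a := evalSeries_C _ a

theorem evalShift_X (c : ℂ) : evalShift A c X = scalarSeries A (shiftInv c) :=
  evalSeries_X (constantCoeff_scalarSeries_shiftInv c)

theorem evalShift_map_C (c : ℂ) (a : A⟦X⟧) : evalShift A c (map C a) = shift c a := by
  ext n
  change coeff n (evalSeries _ _) = _
  rw [evalSeries, shift, coeff_mk, coeff_mk,
    Polynomial.eval_eq_sum_range' (natDegree_trunc_lt _ n), map_sum]
  refine Finset.sum_congr rfl fun r hr => ?_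
  rw [coeff_trunc, if_pos (Finset.mem_range.mp hr), coeff_map, coeff_C_mul, ← map_pow,
    scalarSeries, coeff_map, ← Algebra.commutes, ← Algebra.smul_def, shiftInv]

variable (A) in
/-- The shift `a(u) ↦ a(u + c)` as a homomorphism of algebras. -/
def shiftHom (c : ℂ) : A⟦X⟧ →ₐ[ℂ] A⟦X⟧ where
  __ := (evalShift A c : A⟦X⟧⟦X⟧ →+* A⟦X⟧).comp (map C)
  commutes' r := by
    change evalShift A c (map C (algebraMap ℂ A⟦X⟧ r)) = _
    rw [PowerSeries.algebraMap_apply, map_C, evalShift_C]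

theorem shiftHom_apply (c : ℂ) (a : A⟦X⟧) : shiftHom A c a = shift c a := evalShift_map_C c a

theorem shift_mul (c : ℂ) (a b : A⟦X⟧) : shift c (a * b) = shift c a * shift c b := by
  simp only [← shiftHom_apply, map_mul]

theorem shift_C (c : ℂ) (x : A) : shift c (C x) = C x := by
  rw [← evalShift_map_C, map_C, evalShift_C]

theorem shift_X (c : ℂ) : shift c (X : A⟦X⟧) = scalarSeries A (shiftInv c) := by
  rw [← evalShift_map_C, map_X, evalShift_X]

theorem shift_zero (a : A⟦X⟧) : shift 0 a = a := by
  ext n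
  have hcoeff (r : ℕ) : coeff n ((X * (1 + C 0 * X)⁻¹ : ℂ⟦X⟧) ^ r) = if n = r then 1 else 0 := by
    rw [map_zero, zero_mul, add_zero, inv_one, mul_one, coeff_X_pow]
  simp only [shift, coeff_mk, hcoeff, ite_smul, one_smul, zero_smul, Finset.sum_ite_eq,
    Finset.mem_range, Nat.lt_succ_self, if_true]

variable (A) in
/-- The specialisation `u ↦ u + a`, `v ↦ u + b` of series in the two variables `u⁻¹`, `v⁻¹`. -/
def specialize (a b : ℂ) : A⟦X⟧⟦X⟧ →ₐ[ℂ] A⟦X⟧ :=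
  (evalShift A a).comp (mapAlgHom (shiftHom A b))

theorem specialize_uInv (a b : ℂ) : specialize A a b (uInv A) = scalarSeries A (shiftInv a) := by
  rw [specialize, AlgHom.comp_apply, uInv, mapAlgHom_apply, map_X, evalShift_X]

theorem specialize_atV (a b : ℂ) (s : A⟦X⟧) : specialize A a b (atV s) = shift b s := by
  rw [specialize, AlgHom.comp_apply, atV, mapAlgHom_apply, map_C, evalShift_C]
  exact shiftHom_apply b s

theorem specialize_vInv (a b : ℂ) : specialize A a b (vInv A) = scalarSeries A (shiftInv b) := by
  rw [← shift_X, ← specialize_atV a b, atV, vInv]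

theorem specialize_atU (a b : ℂ) (s : A⟦X⟧) : specialize A a b (atU s) = shift a s := by
  have h : mapAlgHom (shiftHom A b) (atU s) = map C s := by
    ext1 n
    rw [mapAlgHom_apply, atU, coeff_map, coeff_map]
    exact (shiftHom_apply b _).trans (shift_C b _)
  rw [specialize, AlgHom.comp_apply, h, evalShift_map_C]

end Shift

section Relation

variable {R R' B B' : Type*} [CommRing R] [CommRing R'] [Ring B] [Ring B'] [Algebra R B]
  [Algebra R' B'] [Algebra ℂ B] [Algebra ℂ B']

/-- The element `r₀ - r₁ P + r₂ Q` of `End ℂ^{1|2} ⊗ End ℂ^{1|2} ⊗ B`. -/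
def rTens (r₀ r₁ r₂ : R) : Tens B := fun i j k l =>
  r₀ • tensOne i j k l - r₁ • tensP i j k l + r₂ • tensQ i j k l

/-- The relation `(r₀ - r₁ P + r₂ Q) S₁ U₂ = U₂ S₁ (r₀ - r₁ P + r₂ Q)`, the common form of the
defining relation with its denominators cleared and of its specialisations. The coefficients may
lie in any ring of scalars. -/
def RTTRelation (r₀ r₁ r₂ : R) (S U : Fin 3 → Fin 3 → B) : Prop :=
  tensMul (tensMul (rTens r₀ r₁ r₂) (tensFst S)) (tensSnd U) =
    tensMul (tensMul (tensSnd U) (tensFst S)) (rTens r₀ r₁ r₂)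

variable {r₀ r₁ r₂ : R} {S U : Fin 3 → Fin 3 → B}

theorem RTTRelation.map_of_clear {r₀' r₁' r₂' : R'} (f : B →ₐ[ℂ] B') {z : B'}
    (hcomm : ∀ x, z * x = x * z) (hreg : IsLeftRegular z)
    (h₀ : f (algebraMap R B r₀) = z * algebraMap R' B' r₀')
    (h₁ : f (algebraMap R B r₁) = z * algebraMap R' B' r₁')
    (h₂ : f (algebraMap R B r₂) = z * algebraMap R' B' r₂') (h : RTTRelation r₀ r₁ r₂ S U) :
    RTTRelation r₀' r₁' r₂' (fun i j => f (S i j)) (fun i j => f (U i j)) := by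
  have hR : (fun i j k l => f (rTens r₀ r₁ r₂ i j k l)) =
      fun i j k l => z * rTens r₀' r₁' r₂' i j k l := by
    funext i j k l
    simp only [rTens, Algebra.smul_def, map_add, map_sub, map_mul, h₀, h₁, h₂, tensOne, tensP,
      tensQ, apply_ite f, map_one, map_zero, map_pow, map_neg, AlgHom.commutes, mul_add, mul_sub,
      mul_assoc]
  have hS : (fun i j k l => f (tensFst S i j k l)) = tensFst fun i j => f (S i j) := by
    funext i j k l
    simp only [tensFst, apply_ite f, map_zero, map_mul, map_pow, map_neg, map_one]
  have hU : (fun i j k l => f (tensSnd U i j k l)) = tensSnd fun i j => f (U i j) := by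
    funext i j k l
    simp only [tensSnd, apply_ite f, map_zero, map_mul, map_pow, map_neg, map_one]
  have hmul (a b : Tens B) : (fun i j k l => f (tensMul a b i j k l)) =
      tensMul (fun i j k l => f (a i j k l)) (fun i j k l => f (b i j k l)) := by
    funext i j k l
    exact map_tensMul (f : B →+* B') a b i j k l
  have key := congrArg (fun (a : Tens B) i j k l => f (a i j k l)) h
  simp only [hmul, hR, hS, hU, tensMul_smul_left, tensMul_smul_right z hcomm] at key
  funext i j k l
  exact hreg (congr_fun₂ (congr_fun₂ key i j) k l)

theorem RTTRelation.apply (h : RTTRelation r₀ r₁ r₂ S U) (i j k l : Fin 3) :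
    tensMul (tensMul (rTens r₀ r₁ r₂) (tensFst S)) (tensSnd U) i j k l =
      tensMul (tensMul (tensSnd U) (tensFst S)) (rTens r₀ r₁ r₂) i j k l :=
  congr_fun₂ (congr_fun₂ h i j) k l

theorem RTTRelation.apply_00_00 (h : RTTRelation r₀ r₁ r₂ S U) :
    (r₀ + r₁) • (S 0 0 * U 0 0) = (r₀ + r₁) • (U 0 0 * S 0 0) := by
  have := h.apply 0 0 0 0
  simp only [tensMul, rTens, tensFst, tensSnd, tensOne, tensP, tensQ, Fin.sum_univ_three, par,
    theta, Fin.isValue, Fin.reduceEq, Fin.reduceRev, if_true, if_false, and_true, and_false,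
    true_and, false_and] at this
  norm_num [add_mul, mul_add] at this
  linear_combination (norm := module) this

theorem RTTRelation.apply_00_10 (h : RTTRelation r₀ r₁ r₂ S U) :
    r₀ • (S 0 0 * U 1 0) + r₁ • (S 1 0 * U 0 0) = (r₀ + r₁) • (U 1 0 * S 0 0) := by
  have := h.apply 0 0 1 0
  simp only [tensMul, rTens, tensFst, tensSnd, tensOne, tensP, tensQ, Fin.sum_univ_three, par,
    theta, Fin.isValue, Fin.reduceEq, Fin.reduceRev, if_true, if_false, and_true, and_false,
    true_and, false_and] at this
  norm_num [add_mul, mul_add] at this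
  linear_combination (norm := module) -this

theorem RTTRelation.apply_00_01 (h : RTTRelation r₀ r₁ r₂ S U) :
    (r₀ + r₁) • (S 0 0 * U 0 1) = r₀ • (U 0 1 * S 0 0) + r₁ • (U 0 0 * S 0 1) := by
  have := h.apply 0 0 0 1
  simp only [tensMul, rTens, tensFst, tensSnd, tensOne, tensP, tensQ, Fin.sum_univ_three, par,
    theta, Fin.isValue, Fin.reduceEq, Fin.reduceRev, if_true, if_false, and_true, and_false,
    true_and, false_and] at this
  norm_num [add_mul, mul_add] at this
  linear_combination (norm := module) this

theorem RTTRelation.apply_00_11 (h : RTTRelation r₀ r₁ r₂ S U) :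
    r₀ • (S 0 0 * U 1 1) + r₁ • (S 1 0 * U 0 1) =
      r₀ • (U 1 1 * S 0 0) + r₁ • (U 1 0 * S 0 1) := by
  have := h.apply 0 0 1 1
  simp only [tensMul, rTens, tensFst, tensSnd, tensOne, tensP, tensQ, Fin.sum_univ_three, par,
    theta, Fin.isValue, Fin.reduceEq, Fin.reduceRev, if_true, if_false, and_true, and_false,
    true_and, false_and] at this
  norm_num [add_mul, mul_add] at this
  linear_combination (norm := module) this

theorem RTTRelation.apply_00_20 (h : RTTRelation r₀ r₁ r₂ S U) :
    (r₁ + r₂) • (S 2 0 * U 0 0) + r₂ • (S 1 0 * U 1 0) + (r₀ - r₂) • (S 0 0 * U 2 0) =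
      (r₀ + r₁) • (U 2 0 * S 0 0) := by
  have := h.apply 0 0 2 0
  simp only [tensMul, rTens, tensFst, tensSnd, tensOne, tensP, tensQ, Fin.sum_univ_three, par,
    theta, Fin.isValue, Fin.reduceEq, Fin.reduceRev, if_true, if_false, and_true, and_false,
    true_and, false_and] at this
  norm_num [add_mul, mul_add] at this
  linear_combination (norm := module) this

theorem RTTRelation.apply_00_21 (h : RTTRelation r₀ r₁ r₂ S U) :
    (r₁ + r₂) • (S 2 0 * U 0 1) + r₂ • (S 1 0 * U 1 1) + (r₀ - r₂) • (S 0 0 * U 2 1) =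
      r₀ • (U 2 1 * S 0 0) + r₁ • (U 2 0 * S 0 1) := by
  have := h.apply 0 0 2 1
  simp only [tensMul, rTens, tensFst, tensSnd, tensOne, tensP, tensQ, Fin.sum_univ_three, par,
    theta, Fin.isValue, Fin.reduceEq, Fin.reduceRev, if_true, if_false, and_true, and_false,
    true_and, false_and] at this
  norm_num [add_mul, mul_add] at this
  linear_combination (norm := module) this

theorem RTTRelation.apply_00_02 (h : RTTRelation r₀ r₁ r₂ S U) :
    (r₀ + r₁) • (S 0 0 * U 0 2) =
      (r₀ - r₂) • (U 0 2 * S 0 0) - r₂ • (U 0 1 * S 0 1) + (r₁ + r₂) • (U 0 0 * S 0 2) := by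
  have := h.apply 0 0 0 2
  simp only [tensMul, rTens, tensFst, tensSnd, tensOne, tensP, tensQ, Fin.sum_univ_three, par,
    theta, Fin.isValue, Fin.reduceEq, Fin.reduceRev, if_true, if_false, and_true, and_false,
    true_and, false_and] at this
  norm_num [add_mul, mul_add] at this
  linear_combination (norm := module) this

theorem RTTRelation.apply_02_10 (h : RTTRelation r₀ r₁ r₂ S U) :
    r₀ • (S 0 2 * U 1 0) + r₁ • (S 1 2 * U 0 0) =
      (r₁ + r₂) • (U 1 2 * S 0 0) + r₂ • (U 1 1 * S 0 1) + (r₀ - r₂) • (U 1 0 * S 0 2) := by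
  have := h.apply 0 2 1 0
  simp only [tensMul, rTens, tensFst, tensSnd, tensOne, tensP, tensQ, Fin.sum_univ_three, par,
    theta, Fin.isValue, Fin.reduceEq, Fin.reduceRev, if_true, if_false, and_true, and_false,
    true_and, false_and] at this
  norm_num [add_mul, mul_add] at this
  linear_combination (norm := module) -this

end Relation

section TwoVariables

variable {A : Type*} [Ring A] [Algebra ℂ A]

variable (A) in
/-- The variable `u⁻¹` as a central element. -/
def uCentral : Subring.center A⟦X⟧⟦X⟧ :=
  ⟨uInv A, Subring.mem_center_iff.mpr fun _ => X_mul.symm⟩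

variable (A) in
/-- The variable `v⁻¹` as a central element. -/
def vCentral : Subring.center A⟦X⟧⟦X⟧ :=
  ⟨vInv A, Subring.mem_center_iff.mpr fun F => by
    have h : vInv A = atV (scalarSeries A X) := by rw [scalarSeries, map_X, atV, vInv]
    rw [h, atV_scalar_comm]⟩

variable (A) in
/-- The constant `κ` as a central element. -/
def kappaCentral : Subring.center A⟦X⟧⟦X⟧ :=
  ⟨algebraMap ℂ _ kappa, Subring.mem_center_iff.mpr fun F => (Algebra.commutes kappa F).symm⟩

variable (A) in
/-- The denominator `u - v` of the `R`-matrix, multiplied by `u⁻¹ v⁻¹`. -/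
def subCentral : Subring.center A⟦X⟧⟦X⟧ := vCentral A - uCentral A

variable (A) in
/-- The denominator `u - v - κ` of the `R`-matrix, multiplied by `u⁻¹ v⁻¹`. -/
def subKappaCentral : Subring.center A⟦X⟧⟦X⟧ :=
  subCentral A - kappaCentral A * (uCentral A * vCentral A)

theorem rMatrix_eq_rTens : rMatrix A = rTens (subCentral A * subKappaCentral A)
    (uCentral A * vCentral A * subKappaCentral A) (uCentral A * vCentral A * subCentral A) := by
  funext i j k l
  simp only [rMatrix, rTens, Algebra.smul_def kappa]
  rfl

theorem RTTRelation.of_rttDefect_eq_zero {T : Fin 3 → Fin 3 → A⟦X⟧} (hT : rttDefect T = 0) :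
    RTTRelation (subCentral A * subKappaCentral A) (uCentral A * vCentral A * subKappaCentral A)
      (uCentral A * vCentral A * subCentral A)
      (fun i j => atU (T i j)) (fun i j => atV (T i j)) := by
  rw [RTTRelation, ← rMatrix_eq_rTens]
  exact (rttDefect_eq_zero_iff T).mp hT

theorem isLeftRegular_scalarSeries_shiftInv (c : ℂ) :
    IsLeftRegular (scalarSeries A (shiftInv c)) := by
  have hX : IsLeftRegular (X : A⟦X⟧) := X_mul_injective
  have h : scalarSeries A (1 + C c * X) * scalarSeries A (shiftInv c) = X := by
    rw [scalarSeries_comm, ← map_mul, shiftInv_mul, scalarSeries, map_X]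
  exact IsLeftRegular.of_mul (h ▸ hX)

variable (A) in
/-- The series `(u + a)⁻¹ (u + b)⁻¹`, the image of `u⁻¹ v⁻¹` under `specialize`. -/
def shiftInvMul (a b : ℂ) : A⟦X⟧ := scalarSeries A (shiftInv a * shiftInv b)

theorem specialize_uCentral_mul_vCentral (a b : ℂ) :
    specialize A a b (uCentral A * vCentral A : Subring.center A⟦X⟧⟦X⟧) = shiftInvMul A a b := by
  change specialize A a b (uInv A * vInv A) = _
  rw [map_mul, specialize_uInv, specialize_vInv, ← map_mul, shiftInvMul]

theorem specialize_subCentral (a b : ℂ) :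
    specialize A a b (subCentral A) = shiftInvMul A a b * algebraMap ℂ A⟦X⟧ (a - b) := by
  change specialize A a b (vInv A - uInv A) = _
  rw [map_sub, specialize_uInv, specialize_vInv, ← map_sub, shiftInv_sub, map_mul,
    scalarSeries_comm, shiftInvMul, PowerSeries.algebraMap_apply, scalarSeries, map_C]

theorem specialize_subKappaCentral (a b : ℂ) :
    specialize A a b (subKappaCentral A) =
      shiftInvMul A a b * algebraMap ℂ A⟦X⟧ (a - b - kappa) := by
  change specialize A a b (subCentral A - algebraMap ℂ _ kappa *
    (uCentral A * vCentral A : Subring.center A⟦X⟧⟦X⟧)) = _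
  rw [map_sub, map_mul, specialize_subCentral, specialize_uCentral_mul_vCentral, AlgHom.commutes,
    map_sub _ (a - b), mul_sub, Algebra.commutes]

theorem RTTRelation.shift {T : Fin 3 → Fin 3 → A⟦X⟧} (hT : rttDefect T = 0) (a b : ℂ) :
    RTTRelation ((a - b) * (a - b - kappa)) (a - b - kappa) (a - b)
      (fun i j => shift a (T i j)) (fun i j => shift b (T i j)) := by
  have hreg : IsLeftRegular (shiftInvMul A a b) := by
    rw [shiftInvMul, map_mul]
    exact (isLeftRegular_scalarSeries_shiftInv a).mul (isLeftRegular_scalarSeries_shiftInv b)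
  have key := (RTTRelation.of_rttDefect_eq_zero hT).map_of_clear (R' := ℂ)
    (r₀' := (a - b) * (a - b - kappa)) (r₁' := a - b - kappa) (r₂' := a - b)
    (specialize A a b) (z := shiftInvMul A a b * shiftInvMul A a b)
    (fun x => by rw [shiftInvMul, ← map_mul, scalarSeries_comm]) (hreg.mul hreg) ?_ ?_ ?_
  · simpa only [specialize_atU, specialize_atV] using key
  · change specialize A a b (subCentral A * subKappaCentral A) = _
    rw [map_mul, specialize_subCentral, specialize_subKappaCentral, map_mul, mul_assoc, mul_assoc,
      ← mul_assoc (algebraMap _ _ _), Algebra.commutes, mul_assoc]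
  · change specialize A a b ((uCentral A * vCentral A : Subring.center _) * subKappaCentral A) = _
    rw [map_mul, specialize_uCentral_mul_vCentral, specialize_subKappaCentral, mul_assoc]
  · change specialize A a b ((uCentral A * vCentral A : Subring.center _) * subCentral A) = _
    rw [map_mul, specialize_uCentral_mul_vCentral, specialize_subCentral, mul_assoc]

end TwoVariables

section Commutation

variable {R B : Type*} [CommRing R] [Ring B] [Algebra R B] [Algebra ℂ B] {r₀ r₁ r₂ : R}
  {S U : Fin 3 → Fin 3 → B}

theorem RTTRelation.commute_quasidet (h : RTTRelation r₀ r₁ r₂ S U) (hr₀ : IsSMulRegular B r₀)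
    (hr : IsSMulRegular B (r₀ + r₁)) {x : B} (hx : U 0 0 * x = 1) (hx' : x * U 0 0 = 1) :
    Commute (S 0 0) (U 1 1 - U 1 0 * x * U 0 1) := by
  have hcomm : Commute (S 0 0) (U 0 0) := hr h.apply_00_00
  have hcomm' : S 0 0 * x = x * S 0 0 :=
    (hcomm.units_inv_right (u := ⟨U 0 0, x, hx, hx'⟩)).eq
  have h₁₀ : r₀ • (S 0 0 * U 1 0 * x * U 0 1) + r₁ • (S 1 0 * U 0 1) =
      (r₀ + r₁) • (U 1 0 * x * S 0 0 * U 0 1) := by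
    have := congr($(h.apply_00_10) * (x * U 0 1))
    simp only [add_mul, smul_mul_assoc] at this
    rwa [mul_assoc (S 1 0), ← mul_assoc (U 0 0), hx, one_mul, ← mul_assoc, ← mul_assoc,
      mul_assoc (U 1 0) (S 0 0), hcomm', ← mul_assoc] at this
  have h₀₁ : (r₀ + r₁) • (U 1 0 * x * S 0 0 * U 0 1) =
      r₀ • (U 1 0 * x * U 0 1 * S 0 0) + r₁ • (U 1 0 * S 0 1) := by
    have := congr(U 1 0 * x * $(h.apply_00_01))
    simp only [mul_add, mul_smul_comm] at this
    rwa [mul_assoc (U 1 0) x (U 0 0 * _), ← mul_assoc x, hx', one_mul, ← mul_assoc,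
      ← mul_assoc] at this
  refine hr₀ ?_
  have h₁₁ := h.apply_00_11
  simp only [mul_sub, sub_mul, ← mul_assoc]
  linear_combination (norm := module) h₁₁ - h₁₀ - h₀₁

end Commutation

section Regular

variable {A : Type*} [Ring A]

theorem isLeftRegular_vInv_sub_uInv_mul (G : A⟦X⟧⟦X⟧) : IsLeftRegular (vInv A - uInv A * G) := by
  refine isLeftRegular_iff_right_eq_zero_of_mul.mpr fun F hF => ?_
  suffices h : ∀ m, coeff m F = 0 from PowerSeries.ext h
  intro m
  induction m using Nat.strong_induction_on with
  | _ m ih =>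
    have hGF : coeff m (uInv A * (G * F)) = 0 := by
      rw [uInv]
      cases m with
      | zero => rw [coeff_zero_X_mul]
      | succ m =>
        rw [coeff_succ_X_mul, coeff_mul]
        refine Finset.sum_eq_zero fun p hp => ?_
        have := Finset.HasAntidiagonal.antidiagonal.snd_le hp
        rw [ih p.2 (Nat.lt_succ_of_le this), mul_zero]
    have hXF := congrArg (coeff m) hF
    rw [sub_mul, mul_assoc, map_sub, hGF, sub_zero, vInv, coeff_C_mul, map_zero] at hXF
    exact X_mul_injective (hXF.trans (mul_zero X).symm)

theorem commute_of_commute_atU_atV {a b : A⟦X⟧} (h : Commute (atU a) (atV b)) : Commute a b := by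
  ext n
  rw [coeff_mul, coeff_mul, ← Finset.Nat.sum_antidiagonal_swap]
  refine Finset.sum_congr rfl fun p _ => ?_
  simpa only [coeff_atU_mul_atV, coeff_atV_mul_atU, Prod.fst_swap, Prod.snd_swap] using
    congrArg (fun s => coeff p.1 (coeff p.2 s)) h.eq

variable [Algebra ℂ A]

theorem isSMulRegular_subCentral : IsSMulRegular A⟦X⟧⟦X⟧ (subCentral A) := by
  have := isLeftRegular_vInv_sub_uInv_mul (1 : A⟦X⟧⟦X⟧)
  rwa [mul_one] at this

theorem isSMulRegular_subKappaCentral : IsSMulRegular A⟦X⟧⟦X⟧ (subKappaCentral A) := by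
  have := isLeftRegular_vInv_sub_uInv_mul (1 + algebraMap ℂ _ kappa * vInv A)
  rw [mul_add, mul_one, ← sub_sub, ← mul_assoc, ← Algebra.commutes, mul_assoc] at this
  exact this

theorem isSMulRegular_subCentral_add :
    IsSMulRegular A⟦X⟧⟦X⟧ (subCentral A + uCentral A * vCentral A) := by
  have := isLeftRegular_vInv_sub_uInv_mul (1 - vInv A)
  rw [mul_sub, mul_one, sub_sub_eq_add_sub, add_sub_right_comm] at this
  exact this

end Regular

theorem commute_h₁X_h₂X : Commute h₁X h₂X := by
  refine commute_of_commute_atU_atV ?_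
  have hinv : atV (tSeries 0 0) * atV (invSeries (tSeries 0 0)) = 1 := by
    rw [← map_mul, mul_invSeries (tSeries 0 0) constantCoeff_h₁X, map_one]
  have hinv' : atV (invSeries (tSeries 0 0)) * atV (tSeries 0 0) = 1 := by
    rw [← map_mul, invSeries_mul (tSeries 0 0) constantCoeff_h₁X, map_one]
  have key := (RTTRelation.of_rttDefect_eq_zero rttDefect_tSeries).commute_quasidet
    (isSMulRegular_subCentral.mul isSMulRegular_subKappaCentral) ?_ hinv hinv'
  · rw [h₁X, h₂X, map_sub, map_mul, map_mul]
    exact key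
  · rw [← add_mul]
    exact isSMulRegular_subCentral_add.mul isSMulRegular_subKappaCentral

section Gauss

theorem isUnit_h₁X : IsUnit h₁X :=
  ⟨⟨h₁X, invSeries h₁X, mul_invSeries _ constantCoeff_h₁X, invSeries_mul _ constantCoeff_h₁X⟩, rfl⟩

theorem isUnit_shift_h₁X (c : ℂ) : IsUnit (shift c h₁X) := by
  rw [← shiftHom_apply]
  exact isUnit_h₁X.map _

theorem h₁X_mul_eX (j : Fin 3) : h₁X * eX j = tSeries 0 j := by
  rw [eX, ← mul_assoc, mul_invSeries _ constantCoeff_h₁X, one_mul]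

theorem fX_mul_h₁X (j : Fin 3) : fX j * h₁X = tSeries j 0 := by
  rw [fX, mul_assoc, invSeries_mul _ constantCoeff_h₁X, mul_one]

theorem shift_h₁X_mul_shift_eX (c : ℂ) (j : Fin 3) :
    shift c h₁X * shift c (eX j) = shift c (tSeries 0 j) := by
  rw [← shift_mul, h₁X_mul_eX]

theorem shift_fX_mul_shift_h₁X (c : ℂ) (j : Fin 3) :
    shift c (fX j) * shift c h₁X = shift c (tSeries j 0) := by
  rw [← shift_mul, fX_mul_h₁X]

theorem h₁X_mul_kX : h₁X * kX = h₂X := by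
  rw [kX, ← mul_assoc, mul_invSeries _ constantCoeff_h₁X, one_mul]

theorem kX_mul_h₁X : kX * h₁X = h₂X := by
  refine isUnit_h₁X.mul_left_cancel ?_
  rw [← mul_assoc, h₁X_mul_kX, commute_h₁X_h₂X.eq]

theorem h₂X_eq_sub_mul_eX : h₂X = tSeries 1 1 - tSeries 1 0 * eX 1 := by
  rw [h₂X, eX, h₁X, mul_assoc]

theorem h₂X_eq_sub_fX_mul : h₂X = tSeries 1 1 - fX 1 * tSeries 0 1 := by
  rw [h₂X, fX, h₁X]

theorem rttRelation_neg_one {a b : ℂ} (hab : a - b = -1) :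
    RTTRelation (-1 / 2 : ℂ) (1 / 2) (-1)
      (fun i j => shift a (tSeries i j)) (fun i j => shift b (tSeries i j)) := by
  convert RTTRelation.shift rttDefect_tSeries a b using 1 <;> norm_num [hab, kappa]

theorem rttRelation_kappa :
    RTTRelation (0 : ℂ) 0 (-3 / 2) (fun i j => shift (-3 / 2) (tSeries i j)) tSeries := by
  convert RTTRelation.shift rttDefect_tSeries (-3 / 2) 0 using 1 <;> norm_num [kappa, shift_zero]

theorem rttRelation_half :
    RTTRelation (1 : ℂ) 2 (1 / 2) tSeries (fun i j => shift (-1 / 2) (tSeries i j)) := by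
  convert RTTRelation.shift rttDefect_tSeries 0 (-1 / 2) using 1 <;> norm_num [kappa, shift_zero]

theorem shift_h₁X_mul_shift_fX {a b : ℂ} (hab : a - b = -1) :
    shift a h₁X * shift b (fX 1) = shift a (tSeries 1 0) := by
  refine (isUnit_shift_h₁X b).mul_right_cancel ?_
  rw [mul_assoc, shift_fX_mul_shift_h₁X, h₁X]
  linear_combination (norm := module) (-2 : ℂ) • (rttRelation_neg_one hab).apply_00_10

theorem shift_eX_mul_shift_h₁X {a b : ℂ} (hab : a - b = -1) :
    shift b (eX 1) * shift a h₁X = shift a (tSeries 0 1) := by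
  refine (isUnit_shift_h₁X b).mul_left_cancel ?_
  rw [← mul_assoc, shift_h₁X_mul_shift_eX, h₁X]
  linear_combination (norm := module) (2 : ℂ) • (rttRelation_neg_one hab).apply_00_01

theorem h₁X_mul_shift_fX : h₁X * shift 1 (fX 1) = tSeries 1 0 := by
  simpa only [shift_zero] using shift_h₁X_mul_shift_fX (zero_sub (1 : ℂ))

theorem shift_eX_mul_h₁X : shift 1 (eX 1) * h₁X = tSeries 0 1 := by
  simpa only [shift_zero] using shift_eX_mul_shift_h₁X (zero_sub (1 : ℂ))

theorem h₁X_mul_shift_fX_two :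
    h₁X * (shift 1 (fX 2) - 2 * shift 1 (fX 1) ^ 2) = tSeries 2 0 := by
  refine (isUnit_shift_h₁X 1).mul_right_cancel ?_
  have h := (rttRelation_neg_one (zero_sub (1 : ℂ))).apply_00_20
  simp only [shift_zero] at h
  rw [← h₁X, ← shift_fX_mul_shift_h₁X 1 2, ← shift_fX_mul_shift_h₁X 1 1, ← h₁X_mul_shift_fX] at h
  simp only [mul_sub, sub_mul, two_mul, mul_add, add_mul, sq, mul_assoc] at h ⊢
  linear_combination (norm := module) (2 : ℂ) • h

theorem shift_eX_two_mul_h₁X :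
    (shift 1 (eX 2) + 2 * shift 1 (eX 1) ^ 2) * h₁X = tSeries 0 2 := by
  refine (isUnit_shift_h₁X 1).mul_left_cancel ?_
  have h := (rttRelation_neg_one (zero_sub (1 : ℂ))).apply_00_02
  simp only [shift_zero] at h
  rw [← h₁X, ← shift_h₁X_mul_shift_eX 1 2, ← shift_h₁X_mul_shift_eX 1 1, ← shift_eX_mul_h₁X] at h
  simp only [two_mul, mul_add, add_mul, sq, mul_assoc] at h ⊢
  linear_combination (norm := module) (-2 : ℂ) • h

theorem commute_h₁X_shift_h₁X : Commute h₁X (shift (-1 / 2) h₁X) := by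
  have h := rttRelation_half.apply_00_00
  rw [← h₁X] at h
  change _ = _
  linear_combination (norm := module) (1 / 3 : ℂ) • h

theorem h₁X_mul_shift_fX_half :
    h₁X * ((1 / 3 : ℂ) • shift (-1 / 2) (fX 1) + (2 / 3 : ℂ) • shift 1 (fX 1)) =
      shift (-1 / 2) (fX 1) * h₁X := by
  refine (isUnit_shift_h₁X (-1 / 2)).mul_right_cancel ?_
  have h := rttRelation_half.apply_00_10
  rw [← h₁X, ← shift_fX_mul_shift_h₁X, ← h₁X_mul_shift_fX, mul_assoc _ _ h₁X,
    ← commute_h₁X_shift_h₁X.eq] at h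
  simp only [mul_add, add_mul, mul_smul_comm, smul_mul_assoc, mul_assoc] at h ⊢
  linear_combination (norm := module) (1 / 3 : ℂ) • h

theorem shift_eX_half_mul_h₁X :
    ((1 / 3 : ℂ) • shift (-1 / 2) (eX 1) + (2 / 3 : ℂ) • shift 1 (eX 1)) * h₁X =
      h₁X * shift (-1 / 2) (eX 1) := by
  refine (isUnit_shift_h₁X (-1 / 2)).mul_left_cancel ?_
  have h := rttRelation_half.apply_00_01
  rw [← h₁X, ← shift_h₁X_mul_shift_eX, ← shift_eX_mul_h₁X, ← mul_assoc h₁X,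
    commute_h₁X_shift_h₁X.eq] at h
  simp only [mul_add, add_mul, mul_smul_comm, smul_mul_assoc, mul_assoc] at h ⊢
  linear_combination (norm := module) (-1 / 3 : ℂ) • h

theorem lower_quasidet :
    tSeries 2 1 - tSeries 2 0 * eX 1 = shift (-1 / 2) (fX 1) * h₂X := by
  refine (isUnit_shift_h₁X (-3 / 2)).mul_left_cancel ?_
  have h₂₀ := congr($(rttRelation_kappa.apply_00_20) * eX 1)
  have h₂₁ := rttRelation_kappa.apply_00_21
  rw [← mul_assoc, shift_h₁X_mul_shift_fX (by norm_num), h₂X_eq_sub_mul_eX]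
  rw [← h₁X] at h₂₀ h₂₁
  simp only [add_mul, smul_mul_assoc, mul_sub, mul_assoc, h₁X_mul_eX] at h₂₀ h₂₁ ⊢
  linear_combination (norm := module) (2 / 3 : ℂ) • (h₂₁ - h₂₀)

theorem upper_quasidet :
    tSeries 1 2 - fX 1 * tSeries 0 2 = -(h₂X * shift (-1 / 2) (eX 1)) := by
  refine (isUnit_shift_h₁X (-3 / 2)).mul_right_cancel ?_
  have h₀₂ := congr(fX 1 * $(rttRelation_kappa.apply_00_02))
  have h₁₂ := rttRelation_kappa.apply_02_10
  rw [neg_mul, mul_assoc h₂X, shift_eX_mul_shift_h₁X (by norm_num), h₂X_eq_sub_fX_mul]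
  rw [← h₁X] at h₀₂ h₁₂
  simp only [mul_add, mul_sub, sub_mul, mul_smul_comm, ← mul_assoc, fX_mul_h₁X] at h₀₂ h₁₂ ⊢
  linear_combination (norm := module) (2 / 3 : ℂ) • (h₀₂ + h₁₂)

end Gauss

section GeometricSeries

variable {A : Type*} [Ring A] {W d a b c : A⟦X⟧}

theorem constantCoeff_one_add (hW : constantCoeff W = 0) : constantCoeff (1 + W) = 1 := by
  rw [map_add, map_one, hW, add_zero]

theorem hasFormalSum_geometric (hW : constantCoeff W = 0) :
    HasFormalSum (fun r => (-1) ^ r * W ^ r) (invSeries (1 + W)) := by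
  intro n
  refine ⟨n + 1, fun M hM => ?_⟩
  have hsum : ∑ r ∈ Finset.range M, (-1) ^ r * W ^ r =
      invSeries (1 + W) - invSeries (1 + W) * (-W) ^ M := by
    rw [← mul_one_sub, ← mul_neg_geom_sum, sub_neg_eq_add, ← mul_assoc,
      invSeries_mul _ (constantCoeff_one_add hW), one_mul]
    simp only [neg_pow W]
  rw [hsum, map_sub, coeff_mul_pow_of_lt (by rw [map_neg, hW, neg_zero]) _ hM, sub_zero]

theorem exists_hasFormalSum_eq_add_mul_mul (hW : constantCoeff W = 0)
    (h : (1 + W) * (d - a) = b * c) :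
    ∃ S, HasFormalSum (fun r => (-1) ^ r * W ^ r) S ∧ d = a + S * b * c := by
  refine ⟨invSeries (1 + W), hasFormalSum_geometric hW, ?_⟩
  rw [mul_assoc, ← h, ← mul_assoc, invSeries_mul _ (constantCoeff_one_add hW), one_mul,
    add_sub_cancel]

theorem exists_hasFormalSum_eq_add_mul (hW : constantCoeff W = 0)
    (h : (d - a) * (1 + W) = b) :
    ∃ S, HasFormalSum (fun r => (-1) ^ r * W ^ r) S ∧ d = a + b * S := by
  refine ⟨invSeries (1 + W), hasFormalSum_geometric hW, ?_⟩
  rw [← h, mul_assoc, mul_invSeries _ (constantCoeff_one_add hW), mul_one, add_sub_cancel]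

end GeometricSeries

section TensorSquare

/-- The map `a(u) ↦ a(u) ⊗ 1`. -/
def leftS : ExtYangian⟦X⟧ →+* ExtYangianSq⟦X⟧ :=
  map (GradedTensorProduct.includeLeft (superPart parityX) (superPart parityX) : ExtYangian →+* _)

/-- The map `a(u) ↦ 1 ⊗ a(u)`. -/
def rightS : ExtYangian⟦X⟧ →+* ExtYangianSq⟦X⟧ :=
  map (GradedTensorProduct.includeRight (superPart parityX) (superPart parityX) : ExtYangian →+* _)

theorem commute_rightS_leftS {i j k l : Fin 3} (h : Even ((par k + par l) * (par i + par j))) :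
    Commute (rightS (tSeries k l)) (leftS (tSeries i j)) := by
  ext n
  rw [coeff_mul, coeff_mul, ← Finset.Nat.sum_antidiagonal_swap]
  refine Finset.sum_congr rfl fun p _ => ?_
  have := includeRight_mul_includeLeft (superPart parityX) (superPart parityX)
    (coeff_tSeries_mem i j p.1) (coeff_tSeries_mem k l p.2)
  rwa [h.neg_one_pow, one_mul] at this

theorem commute_rightS_h₁X_leftS (i j : Fin 3) :
    Commute (rightS h₁X) (leftS (tSeries i j)) :=
  commute_rightS_leftS (by simp [par])

theorem commute_leftS_h₁X_rightS (i j : Fin 3) :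
    Commute (leftS h₁X) (rightS (tSeries i j)) :=
  (commute_rightS_leftS (by simp [par])).symm

theorem commute_rightS_h₁X_leftS_eX (j : Fin 3) : Commute (rightS h₁X) (leftS (eX j)) := by
  refine (isUnit_h₁X.map leftS).mul_left_cancel ?_
  have h₁ : Commute (rightS h₁X) (leftS h₁X) := commute_rightS_h₁X_leftS 0 0
  rw [← mul_assoc, ← h₁.eq, mul_assoc, ← mul_assoc (leftS _), ← map_mul, h₁X_mul_eX,
    (commute_rightS_h₁X_leftS 0 j).eq]

theorem commute_leftS_h₁X_rightS_fX (j : Fin 3) : Commute (leftS h₁X) (rightS (fX j)) := by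
  refine (isUnit_h₁X.map rightS).mul_right_cancel ?_
  have h₁ : Commute (leftS h₁X) (rightS h₁X) := commute_leftS_h₁X_rightS 0 0
  rw [mul_assoc, mul_assoc, h₁.eq, ← mul_assoc (rightS _), ← map_mul, fX_mul_h₁X,
    (commute_leftS_h₁X_rightS j 0).eq]

/-- The coproduct of the extended Yangian, applied coefficientwise to series. -/
def deltaX : ExtYangian⟦X⟧ →+* ExtYangianSq⟦X⟧ :=
  map (coproductX : ExtYangian →+* ExtYangianSq)

theorem deltaX_tSeries (i j : Fin 3) : deltaX (tSeries i j) =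
    leftS (tSeries i 0) * rightS (tSeries 0 j) + leftS (tSeries i 1) * rightS (tSeries 1 j) +
      leftS (tSeries i 2) * rightS (tSeries 2 j) := by
  rw [deltaX, map_coproductX, Fin.sum_univ_three]
  simp only [seriesTmul_eq]
  rfl

theorem deltaX_h₁X : deltaX h₁X = leftS h₁X * rightS h₁X +
    leftS (tSeries 0 1) * rightS (tSeries 1 0) + leftS (tSeries 0 2) * rightS (tSeries 2 0) :=
  deltaX_tSeries 0 0

theorem isUnit_leftS_mul_rightS_h₁X : IsUnit (leftS h₁X * rightS h₁X) :=
  (isUnit_h₁X.map leftS).mul (isUnit_h₁X.map rightS)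

/-- The series `e(u) ⊗ f(u + 1) + e_{11'}(u) ⊗ (f_{1'1}(u + 1) - 2 f(u + 1)²)`, the deviation of
`(h₁(u) ⊗ h₁(u))⁻¹ Δ(h₁(u))` from `1`. -/
def upperKernel : ExtYangianSq⟦X⟧ :=
  leftS (eX 1) * rightS (shift 1 (fX 1)) +
    leftS (eX 2) * rightS (shift 1 (fX 2) - 2 * shift 1 (fX 1) ^ 2)

/-- The series `e(u + 1) ⊗ f(u) + (e_{11'}(u + 1) + 2 e(u + 1)²) ⊗ f_{1'1}(u)`, the deviation of
`Δ(h₁(u)) (h₁(u) ⊗ h₁(u))⁻¹` from `1`. -/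
def lowerKernel : ExtYangianSq⟦X⟧ :=
  leftS (shift 1 (eX 1)) * rightS (fX 1) +
    leftS (shift 1 (eX 2) + 2 * shift 1 (eX 1) ^ 2) * rightS (fX 2)

theorem h₁X_tmul_h₁X_mul_one_add_upperKernel :
    leftS h₁X * rightS h₁X * (1 + upperKernel) = deltaX h₁X := by
  rw [deltaX_h₁X, upperKernel, mul_add, mul_one, mul_add,
    (commute_rightS_h₁X_leftS_eX 1).mul_mul_mul_comm,
    (commute_rightS_h₁X_leftS_eX 2).mul_mul_mul_comm, ← map_mul, ← map_mul, ← map_mul, ← map_mul,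
    h₁X_mul_eX, h₁X_mul_eX, h₁X_mul_shift_fX, h₁X_mul_shift_fX_two, add_assoc]

theorem one_add_lowerKernel_mul_h₁X_tmul_h₁X :
    (1 + lowerKernel) * (leftS h₁X * rightS h₁X) = deltaX h₁X := by
  rw [deltaX_h₁X, lowerKernel, add_mul, one_mul, add_mul,
    (commute_leftS_h₁X_rightS_fX 1).symm.mul_mul_mul_comm,
    (commute_leftS_h₁X_rightS_fX 2).symm.mul_mul_mul_comm, ← map_mul, ← map_mul, ← map_mul,
    ← map_mul, fX_mul_h₁X, fX_mul_h₁X, shift_eX_mul_h₁X, shift_eX_two_mul_h₁X, add_assoc]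

theorem one_add_upperKernel_mul :
    (1 + upperKernel) * (deltaX (eX 1) - rightS (eX 1)) =
      (leftS (eX 1) + leftS (eX 2) *
        rightS ((1 / 3 : ℂ) • shift (-1 / 2) (fX 1) + (2 / 3 : ℂ) • shift 1 (fX 1))) *
        rightS kX := by
  refine isUnit_leftS_mul_rightS_h₁X.mul_left_cancel ?_
  have hleft : deltaX h₁X * (deltaX (eX 1) - rightS (eX 1)) =
      leftS (tSeries 0 1) * rightS h₂X +
        leftS (tSeries 0 2) * rightS (shift (-1 / 2) (fX 1) * h₂X) := by
    rw [mul_sub, ← map_mul, h₁X_mul_eX, deltaX_tSeries, deltaX_h₁X, ← lower_quasidet,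
      h₂X_eq_sub_mul_eX, ← h₁X_mul_eX 1]
    simp only [h₁X, map_sub, map_mul, mul_sub, add_mul, mul_assoc]
    abel
  rw [← mul_assoc, h₁X_tmul_h₁X_mul_one_add_upperKernel, hleft, add_mul (leftS (eX 1)),
    mul_assoc (leftS (eX 2)), mul_add, (commute_rightS_h₁X_leftS_eX 1).mul_mul_mul_comm,
    (commute_rightS_h₁X_leftS_eX 2).mul_mul_mul_comm]
  simp only [← map_mul]
  rw [← mul_assoc h₁X, h₁X_mul_shift_fX_half, mul_assoc, h₁X_mul_kX, h₁X_mul_eX, h₁X_mul_eX]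

theorem mul_one_add_lowerKernel :
    (deltaX (fX 1) - leftS (fX 1)) * (1 + lowerKernel) =
      leftS kX * (rightS (fX 1) -
        leftS ((1 / 3 : ℂ) • shift (-1 / 2) (eX 1) + (2 / 3 : ℂ) • shift 1 (eX 1)) *
          rightS (fX 2)) := by
  refine isUnit_leftS_mul_rightS_h₁X.mul_right_cancel ?_
  have hleft : (deltaX (fX 1) - leftS (fX 1)) * deltaX h₁X =
      leftS h₂X * rightS (tSeries 1 0) -
        leftS (h₂X * shift (-1 / 2) (eX 1)) * rightS (tSeries 2 0) := by
    rw [sub_mul, ← map_mul, fX_mul_h₁X, deltaX_tSeries, deltaX_h₁X,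
      ← neg_neg (h₂X * shift (-1 / 2) (eX 1)), ← upper_quasidet, h₂X_eq_sub_fX_mul,
      ← fX_mul_h₁X 1]
    simp only [h₁X, map_sub, map_neg, map_mul, sub_mul, neg_mul, mul_add, mul_assoc]
    abel
  have hf : rightS (fX 1) * (leftS h₁X * rightS h₁X) = leftS h₁X * rightS (fX 1 * h₁X) := by
    rw [map_mul, ← mul_assoc, ← mul_assoc, (commute_leftS_h₁X_rightS_fX 1).eq]
  rw [mul_assoc, one_add_lowerKernel_mul_h₁X_tmul_h₁X, hleft, mul_assoc (leftS kX), sub_mul, hf,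
    (commute_leftS_h₁X_rightS_fX 2).symm.mul_mul_mul_comm, mul_sub, ← mul_assoc (leftS kX),
    ← mul_assoc (leftS kX)]
  simp only [← map_mul]
  rw [shift_eX_half_mul_h₁X, ← mul_assoc kX, kX_mul_h₁X, fX_mul_h₁X, fX_mul_h₁X]

theorem constantCoeff_leftS_eX {j : Fin 3} (hj : j ≠ 0) : constantCoeff (leftS (eX j)) = 0 := by
  rw [leftS, constantCoeff_map, eX, map_mul, constantCoeff_tSeries, if_neg hj.symm, mul_zero,
    map_zero]

theorem constantCoeff_rightS_fX {j : Fin 3} (hj : j ≠ 0) : constantCoeff (rightS (fX j)) = 0 := by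
  rw [rightS, constantCoeff_map, fX, map_mul, constantCoeff_tSeries, if_neg hj, zero_mul,
    map_zero]

theorem constantCoeff_upperKernel : constantCoeff upperKernel = 0 := by
  rw [upperKernel, map_add, map_mul, map_mul, constantCoeff_leftS_eX one_ne_zero,
    constantCoeff_leftS_eX (by decide), zero_mul, zero_mul, add_zero]

theorem constantCoeff_lowerKernel : constantCoeff lowerKernel = 0 := by
  rw [lowerKernel, map_add, map_mul, map_mul, constantCoeff_rightS_fX one_ne_zero,
    constantCoeff_rightS_fX (by decide), mul_zero, mul_zero, add_zero]

end TensorSquare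

section Restriction

variable {A B : Type*} [Ring A] [Ring B] [Algebra ℂ A] [Algebra ℂ B]

theorem map_smul_series (f : A →ₐ[ℂ] B) (c : ℂ) (a : A⟦X⟧) :
    map (f : A →+* B) (c • a) = c • map (f : A →+* B) a :=
  map_smul (mapAlgHom f) c a

theorem map_shift (f : A →ₐ[ℂ] B) (c : ℂ) (a : A⟦X⟧) :
    map (f : A →+* B) (shift c a) = shift c (map (f : A →+* B) a) := by
  ext n
  simp [shift]

/-- The embedding of series over the Yangian into those over the extended Yangian. -/
def valY : Yangian⟦X⟧ →+* ExtYangian⟦X⟧ :=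
  map (Yangian.val : Yangian →+* ExtYangian)

theorem valY_toY (a : ExtYangian⟦X⟧) (h : ∀ n, coeff n a ∈ Yangian) : valY (toY a h) = a := by
  ext n
  simp [valY, toY]

theorem valY_eY : valY eY = eX 1 := valY_toY _ _

theorem valY_e₁₁Y : valY e₁₁Y = eX 2 := valY_toY _ _

theorem valY_fY : valY fY = fX 1 := valY_toY _ _

theorem valY_f₁₁Y : valY f₁₁Y = fX 2 := valY_toY _ _

theorem valY_kY : valY kY = kX := valY_toY _ _

theorem valY_shift (c : ℂ) (a : Yangian⟦X⟧) : valY (shift c a) = shift c (valY a) :=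
  map_shift _ c a

theorem valY_smul (c : ℂ) (a : Yangian⟦X⟧) : valY (c • a) = c • valY a :=
  map_smul_series _ c a

/-- The embedding of series over `Y ⊗ Y` into those over `X ⊗ X`. -/
def inclSeries : YangianSq⟦X⟧ →+* ExtYangianSq⟦X⟧ :=
  map (inclSq : YangianSq →+* ExtYangianSq)

theorem inclSeries_injective : Function.Injective inclSeries :=
  map_injective _ inclSq_injective

theorem inclSeries_tmulY (a b : Yangian⟦X⟧) :
    inclSeries (tmulY a b) = leftS (valY a) * rightS (valY b) := by
  rw [inclSeries, tmulY, inclSq, map_superMap, seriesTmul_eq]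
  rfl

theorem inclSeries_deltaSeries (a : Yangian⟦X⟧) :
    inclSeries (deltaSeries a) = deltaX (valY a) := by
  ext n
  exact inclSq_coproductY _

theorem constantCoeff_eq_zero_of_inclSeries {W : YangianSq⟦X⟧}
    (h : constantCoeff (inclSeries W) = 0) : constantCoeff W = 0 := by
  rw [inclSeries, constantCoeff_map] at h
  exact inclSq_injective (h.trans (map_zero _).symm)

/-- The series `e(u) ⊗ f(u + 1) + e_{11'}(u) ⊗ (f_{1'1}(u + 1) - 2 f(u + 1)²)` over `Y ⊗ Y`. -/
def upperKernelY : YangianSq⟦X⟧ :=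
  tmulY eY (shift 1 fY) + tmulY e₁₁Y (shift 1 f₁₁Y - 2 * shift 1 fY ^ 2)

/-- The series `e(u + 1) ⊗ f(u) + (e_{11'}(u + 1) + 2 e(u + 1)²) ⊗ f_{1'1}(u)` over `Y ⊗ Y`. -/
def lowerKernelY : YangianSq⟦X⟧ :=
  tmulY (shift 1 eY) fY + tmulY (shift 1 e₁₁Y + 2 * shift 1 eY ^ 2) f₁₁Y

theorem inclSeries_upperKernelY : inclSeries upperKernelY = upperKernel := by
  simp only [upperKernelY, upperKernel, map_add inclSeries, inclSeries_tmulY, map_sub valY,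
    map_mul valY, map_pow valY, map_ofNat valY, valY_shift, valY_eY, valY_e₁₁Y, valY_fY, valY_f₁₁Y]

theorem inclSeries_lowerKernelY : inclSeries lowerKernelY = lowerKernel := by
  simp only [lowerKernelY, lowerKernel, map_add inclSeries, inclSeries_tmulY, map_add valY,
    map_mul valY, map_pow valY, map_ofNat valY, valY_shift, valY_eY, valY_e₁₁Y, valY_fY, valY_f₁₁Y]

theorem constantCoeff_upperKernelY : constantCoeff upperKernelY = 0 :=
  constantCoeff_eq_zero_of_inclSeries <| by
    rw [inclSeries_upperKernelY, constantCoeff_upperKernel]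

theorem constantCoeff_lowerKernelY : constantCoeff lowerKernelY = 0 :=
  constantCoeff_eq_zero_of_inclSeries <| by
    rw [inclSeries_lowerKernelY, constantCoeff_lowerKernel]

theorem one_add_upperKernelY_mul :
    (1 + upperKernelY) * (deltaSeries eY - tmulY 1 eY) =
      (tmulY eY 1 + tmulY e₁₁Y ((1 / 3 : ℂ) • shift (-1 / 2) fY + (2 / 3 : ℂ) • shift 1 fY)) *
        tmulY 1 kY := by
  apply inclSeries_injective
  simpa only [map_mul inclSeries, map_add inclSeries, map_sub inclSeries, map_one inclSeries,
    inclSeries_upperKernelY, inclSeries_tmulY, inclSeries_deltaSeries, map_one valY, map_one leftS,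
    map_one rightS, map_add valY, valY_smul, valY_shift, valY_eY, valY_e₁₁Y, valY_fY, valY_kY,
    one_mul, mul_one] using one_add_upperKernel_mul

theorem mul_one_add_lowerKernelY :
    (deltaSeries fY - tmulY fY 1) * (1 + lowerKernelY) =
      tmulY kY 1 * (tmulY 1 fY -
        tmulY ((1 / 3 : ℂ) • shift (-1 / 2) eY + (2 / 3 : ℂ) • shift 1 eY) f₁₁Y) := by
  apply inclSeries_injective
  simpa only [map_mul inclSeries, map_add inclSeries, map_sub inclSeries, map_one inclSeries,
    inclSeries_lowerKernelY, inclSeries_tmulY, inclSeries_deltaSeries, map_one valY, map_one leftS,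
    map_one rightS, map_add valY, valY_smul, valY_shift, valY_eY, valY_f₁₁Y, valY_fY, valY_kY,
    one_mul, mul_one] using mul_one_add_lowerKernel

end Restriction

end OspYangian

end

theorem proposition4p7 :
    (∃ S : YangianSq⟦X⟧,
      HasFormalSum (fun r => (-1) ^ r *
        (tmulY eY (shift 1 fY) +
          tmulY e₁₁Y
            (shift 1 f₁₁Y - 2 * shift 1 fY ^ 2)) ^ r) S ∧
      deltaSeries eY =
        tmulY 1 eY +
          S * (tmulY eY 1 +
            tmulY e₁₁Y
              ((1 / 3 : ℂ) • shift (-1 / 2) fY +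
                (2 / 3 : ℂ) • shift 1 fY)) *
            tmulY 1 kY) ∧
    (∃ S : YangianSq⟦X⟧,
      HasFormalSum (fun r => (-1) ^ r *
        (tmulY (shift 1 eY) fY +
          tmulY
            (shift 1 e₁₁Y + 2 * shift 1 eY ^ 2)
            f₁₁Y) ^ r) S ∧
      deltaSeries fY =
        tmulY fY 1 +
          tmulY kY 1 *
            (tmulY 1 fY -
              tmulY
                ((1 / 3 : ℂ) • shift (-1 / 2) eY +
                  (2 / 3 : ℂ) • shift 1 eY) f₁₁Y) * S) := by
  exact ⟨exists_hasFormalSum_eq_add_mul_mul constantCoeff_upperKernelY one_add_upperKernelY_mul,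
    exists_hasFormalSum_eq_add_mul constantCoeff_lowerKernelY mul_one_add_lowerKernelY⟩
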